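/- Let $n\ge 0$ be an integer, let $S_n$ be the symmetric group on $\{1,\dots,n\}$, and for a partition $\lambda$ of $n$ let $V_\lambda$ be the irreducible $S_n$-module over $\mathbb{Q}$ labelled by $\lambda$ (the Specht module: the span of the polytabloids of shape $\lambda$ in the permutation module on the tabloids of shape $\lambda$). Let $L\mathcal{P}(n)$ be the $\mathbb{Q}$-vector space with basis the power set of $\{1,\dots,n\}$, where $S_n$ acts by $\pi\cdot A=\pi(A)$. Let $\mathcal{S}f(n)=\mathbb{Q}[x_1,\dots,x_n]/\langle x_1^2,\dots,x_n^2\rangle$, where $S_n$ acts by algebra automorphisms with $\pi\cdot x_i=x_{\pi(i)}$, and let $\mathcal{S}f_k(n)$ be its homogeneous component of degree $k$. For $A\subseteq\{1,\dots,n\}$ put $x_A=\prod_{a\in A}x_a$. For $0\le i\le k$ let $F_i\mathcal{S}f_k(n)$ be the span of the elements $$\sigma_k^n(A)=\sum_{C\supseteq A,\ |C|=k}x_C,\qquad A\subseteq\{1,\dots,n\},\ |A|=i .$$ Then there are isomorphisms of $S_n$-modules as follows. 1. $$L\mathcal{P}(n)\;\cong\;\mathcal{S}f(n)\;\cong\;\bigoplus_{k=0}^{\lfloor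 n/2\rfloor}(n-2k+1)\,V_{(n-k,k)}=(n+1)V_{(n)}\oplus(n-1)V_{(n-1,1)}\oplus\dots\oplus r\,V_{(\lceil n/2\rceil,\lfloor n/2\rfloor)},$$ where $mV$ is the direct sum of $m$ copies of $V$ and $r=\lceil n/2\rceil-\lfloor n/2\rfloor+1$. 2. For all integers $0\le i\le k\le n/2$: $$\mathcal{S}f_k(n)\cong\mathcal{S}f_{n-k}(n),$$ $$F_i\mathcal{S}f_k(n)\cong V_{(n)}\oplus V_{(n-1,1)}\oplus\dots\oplus V_{(n-i,i)},$$ $$\mathcal{S}f_k(n)\cong V_{(n)}\oplus V_{(n-1,1)}\oplus\dots\oplus V_{(n-k,k)}.$$ -/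

import Mathlib

open scoped Pointwise

noncomputable section

namespace SqFree

/-! ### Specht modules -/

/-- Tabloids of shape `μ` with entries `1, …, n`. A tabloid is a Young tableau up to permuting
the entries inside each row, so it amounts to the function sending an entry to the index of its
row; row `i` must contain exactly `μ.rowLen i` entries. -/
def Tabloid (n : ℕ) (μ : YoungDiagram) : Type :=
  {r : Fin n → ℕ // ∀ i : ℕ, (Finset.univ.filter fun x => r x = i).card = μ.rowLen i}

/-- `π` acts on tabloids by replacing each entry `x` by `π x`: the row of `x` in `π • T` is the
row of `π⁻¹ x` in `T`. -/
instance (n : ℕ) (μ : YoungDiagram) : MulAction (Equiv.Perm (Fin n)) (Tabloid n μ) where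
  smul π T := ⟨fun x => T.1 (π⁻¹ x), fun i => by
    rw [← T.2 i]
    refine Finset.card_bij (fun x _ => π⁻¹ x) ?_ ?_ ?_
    · intro x hx
      simpa using hx
    · intro x _ y _ h
      exact (π⁻¹).injective h
    · intro y hy
      exact ⟨π y, by simpa using hy, by simp⟩⟩
  one_smul T := Subtype.ext (funext fun _ => rfl)
  mul_smul π ρ T := Subtype.ext (funext fun x => by
    change T.1 ((π * ρ)⁻¹ x) = T.1 (ρ⁻¹ (π⁻¹ x))
    rw [mul_inv_rev, Equiv.Perm.mul_apply])

/-- Young tableaux of shape `μ` (bijective fillings with the entries `1, …, n`), given by the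
position of each entry. There are none unless `μ` has exactly `n` cells. -/
abbrev Tableau (n : ℕ) (μ : YoungDiagram) : Type := Fin n ≃ μ.cells

/-- The tabloid `{t}` of a tableau `t`. Cells are pairs `(row, column)`. -/
def Tableau.tabloid {n : ℕ} {μ : YoungDiagram} (t : Tableau n μ) : Tabloid n μ :=
  ⟨fun x => (t x).1.1, fun i => by
    rw [YoungDiagram.rowLen_eq_card]
    refine Finset.card_bij (fun x _ => (t x).1) ?_ ?_ ?_
    · intro x hx
      rw [YoungDiagram.mem_row_iff]
      exact ⟨(t x).2, by simpa using hx⟩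
    · intro x _ y _ h
      exact t.injective (Subtype.ext h)
    · intro c hc
      rw [YoungDiagram.mem_row_iff] at hc
      exact ⟨t.symm ⟨c, hc.1⟩, by simpa using hc.2, by simp⟩⟩

/-- The permutations preserving every column of the tableau `t`. -/
def Tableau.columnStabilizer {n : ℕ} {μ : YoungDiagram} (t : Tableau n μ) :
    Finset (Equiv.Perm (Fin n)) :=
  Finset.univ.filter fun σ => ∀ x, (t (σ x)).1.2 = (t x).1.2

/-- The permutation module `M^μ` over `ℚ` with basis the tabloids of shape `μ`. -/
abbrev permModule (n : ℕ) (μ : YoungDiagram) :=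
  Representation.ofMulAction ℚ (Equiv.Perm (Fin n)) (Tabloid n μ)

/-- The polytabloid `e_t = ∑ sgn(σ) σ{t}`, the sum being over the column stabilizer of `t`. -/
def Tableau.polytabloid {n : ℕ} {μ : YoungDiagram} (t : Tableau n μ) :
    MonoidAlgebra ℚ (Tabloid n μ) :=
  ∑ σ ∈ t.columnStabilizer,
    MonoidAlgebra.single (σ • t.tabloid) (((Equiv.Perm.sign σ : ℤˣ) : ℤ) : ℚ)

theorem permModule_polytabloid {n : ℕ} {μ : YoungDiagram} (π : Equiv.Perm (Fin n))
    (t : Tableau n μ) :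
    permModule n μ π t.polytabloid = Tableau.polytabloid (π.symm.trans t : Tableau n μ) := by
  unfold Tableau.polytabloid
  rw [map_sum]
  refine Finset.sum_bij (fun σ _ => π * σ * π⁻¹) ?_ ?_ ?_ ?_
  · intro σ hσ
    simp only [Tableau.columnStabilizer, Finset.mem_filter, Finset.mem_univ, true_and] at hσ ⊢
    intro x
    have := hσ (π⁻¹ x)
    simpa using this
  · intro σ _ τ _ h
    simpa using h
  · intro σ hσ
    refine ⟨π⁻¹ * σ * π, ?_, by group⟩
    simp only [Tableau.columnStabilizer, Finset.mem_filter, Finset.mem_univ, true_and] at hσ ⊢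
    intro x
    have := hσ (π x)
    simpa using this
  · intro σ _
    rw [Representation.ofMulAction_single]
    have h1 : Tableau.tabloid (π.symm.trans t : Tableau n μ) = π • t.tabloid := rfl
    rw [h1, smul_smul, smul_smul]
    have h2 : Equiv.Perm.sign (π * σ * π⁻¹) = Equiv.Perm.sign σ := by
      rw [Equiv.Perm.sign_mul, Equiv.Perm.sign_mul, Equiv.Perm.sign_inv, mul_right_comm,
        Int.units_mul_self, one_mul]
    rw [h2, inv_mul_cancel_right]

/-- The Specht module `V_μ` over `ℚ`: the subrepresentation of `M^μ` spanned by all polytabloids.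
When `μ` is a partition of `n`, this is the irreducible representation of the symmetric group
`S_n` labelled by `μ`. -/
def specht (n : ℕ) (μ : YoungDiagram) : Subrepresentation (permModule n μ) where
  toSubmodule := Submodule.span ℚ (Set.range (Tableau.polytabloid (n := n) (μ := μ)))
  apply_mem_toSubmodule π v hv := by
    induction hv using Submodule.span_induction with
    | mem x hx =>
      obtain ⟨t, rfl⟩ := hx
      rw [permModule_polytabloid]
      exact Submodule.subset_span ⟨_, rfl⟩
    | zero => simp
    | add x y _ _ hx hy => rw [map_add]; exact Submodule.add_mem _ hx hy
    | smul a x _ hx => rw [map_smul]; exact Submodule.smul_mem _ a hx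

/-- The Young diagram of the partition `(n - k, k)`, for `0 ≤ k ≤ ⌊n/2⌋`. -/
def twoRow (n : ℕ) (k : Fin (n / 2 + 1)) : YoungDiagram :=
  YoungDiagram.ofRowLens [n - k, k] (by
    have := k.2
    simp [List.sortedGE_iff_pairwise]
    omega)

/-- The underlying space of `V_(n-k,k)`. -/
abbrev VSpace (n : ℕ) (k : Fin (n / 2 + 1)) : Type := (specht n (twoRow n k)).toSubmodule

/-- The `S_n`-module `V_(n-k,k)`, for `0 ≤ k ≤ ⌊n/2⌋`. -/
abbrev V (n : ℕ) (k : Fin (n / 2 + 1)) :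
    Representation ℚ (Equiv.Perm (Fin n)) (VSpace n k) :=
  (specht n (twoRow n k)).toRepresentation

/-! ### The power set and the square free polynomials -/

/-- `LP(n)`: the `ℚ`-span of the power set, with the action induced by `π • A = π(A)`. -/
abbrev LP (n : ℕ) :
    Representation ℚ (Equiv.Perm (Fin n)) (MonoidAlgebra ℚ (Finset (Fin n))) :=
  Representation.ofMulAction ℚ (Equiv.Perm (Fin n)) (Finset (Fin n))

/-- The ideal `⟨x_1², …, x_n²⟩`. -/
def sqIdeal (n : ℕ) : Ideal (MvPolynomial (Fin n) ℚ) :=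
  Ideal.span (Set.range fun i => MvPolynomial.X i ^ 2)

/-- The algebra `ℚ[x_1, …, x_n] / ⟨x_1², …, x_n²⟩`. -/
abbrev SfAlg (n : ℕ) : Type := MvPolynomial (Fin n) ℚ ⧸ sqIdeal n

theorem sqIdeal_le_comap (n : ℕ) (π : Equiv.Perm (Fin n)) :
    sqIdeal n ≤ (sqIdeal n).comap (MvPolynomial.rename (R := ℚ) π) := by
  unfold sqIdeal
  rw [Ideal.span_le]
  rintro _ ⟨i, rfl⟩
  exact Ideal.subset_span ⟨π i, by simp⟩

/-- The algebra map of `Sf(n)` induced by `x_i ↦ x_{π i}`. -/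
def sfMap (n : ℕ) (π : Equiv.Perm (Fin n)) : SfAlg n →ₐ[ℚ] SfAlg n :=
  Ideal.quotientMapₐ (sqIdeal n) (MvPolynomial.rename π) (sqIdeal_le_comap n π)

@[simp] theorem sfMap_mk (n : ℕ) (π : Equiv.Perm (Fin n)) (p : MvPolynomial (Fin n) ℚ) :
    sfMap n π (Ideal.Quotient.mk (sqIdeal n) p) =
      Ideal.Quotient.mk (sqIdeal n) (MvPolynomial.rename π p) := rfl

/-- `Sf(n)` as an `S_n`-module. -/
def Sf (n : ℕ) : Representation ℚ (Equiv.Perm (Fin n)) (SfAlg n) where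
  toFun π := (sfMap n π).toLinearMap
  map_one' := LinearMap.ext fun x => by
    obtain ⟨p, rfl⟩ := Ideal.Quotient.mk_surjective x
    rw [AlgHom.toLinearMap_apply, sfMap_mk, Equiv.Perm.coe_one, MvPolynomial.rename_id_apply]
    rfl
  map_mul' π ρ := LinearMap.ext fun x => by
    obtain ⟨p, rfl⟩ := Ideal.Quotient.mk_surjective x
    rw [Module.End.mul_apply, AlgHom.toLinearMap_apply, AlgHom.toLinearMap_apply,
      AlgHom.toLinearMap_apply, sfMap_mk, sfMap_mk, sfMap_mk, MvPolynomial.rename_rename, Equiv.Perm.coe_mul]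

theorem Sf_mk (n : ℕ) (π : Equiv.Perm (Fin n)) (p : MvPolynomial (Fin n) ℚ) :
    Sf n π (Ideal.Quotient.mk (sqIdeal n) p) =
      Ideal.Quotient.mk (sqIdeal n) (MvPolynomial.rename π p) := rfl

/-- The homogeneous component `Sf_k(n)` of degree `k`. -/
def SfHom (n k : ℕ) : Subrepresentation (Sf n) where
  toSubmodule := (MvPolynomial.homogeneousSubmodule (Fin n) ℚ k).map
    (Ideal.Quotient.mkₐ ℚ (sqIdeal n)).toLinearMap
  apply_mem_toSubmodule π v hv := by
    obtain ⟨p, hp, rfl⟩ := hv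
    refine ⟨MvPolynomial.rename π p, ?_, rfl⟩
    exact MvPolynomial.IsHomogeneous.rename_isHomogeneous hp

/-- The square free monomial `x_A = ∏_{a ∈ A} x_a` in `Sf(n)`. -/
def mono {n : ℕ} (A : Finset (Fin n)) : SfAlg n :=
  Ideal.Quotient.mk (sqIdeal n) (∏ a ∈ A, MvPolynomial.X a)

theorem Sf_mono {n : ℕ} (π : Equiv.Perm (Fin n)) (A : Finset (Fin n)) :
    Sf n π (mono A) = mono (π • A) := by
  unfold mono
  rw [Sf_mk, map_prod]
  congr 1
  simp only [MvPolynomial.rename_X]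
  rw [Finset.smul_finset_def, Finset.prod_image (fun x _ y _ h => by simpa using h)]
  rfl

/-- For `|A| ≤ k`, the element `σ_k^n(A) = ∑ x_{A ⊔ B}`, summed over the subsets `B` of the
complement of `A` with `|B| = k - |A|`; that is, the sum of `x_C` over the `k`-element sets `C`
containing `A`. -/
def sigma {n : ℕ} (k : ℕ) (A : Finset (Fin n)) : SfAlg n :=
  ∑ C ∈ (Finset.powersetCard k (Finset.univ : Finset (Fin n))).filter fun C => A ⊆ C, mono C

theorem Sf_sigma {n : ℕ} (π : Equiv.Perm (Fin n)) (k : ℕ) (A : Finset (Fin n)) :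
    Sf n π (sigma k A) = sigma k (π • A) := by
  unfold sigma
  rw [map_sum]
  refine Finset.sum_bij (fun C _ => π • C) ?_ ?_ ?_ ?_
  · intro C hC
    simpa [Finset.mem_powersetCard] using hC
  · intro C _ D _ h
    simpa using h
  · intro C hC
    refine ⟨π⁻¹ • C, ?_, by simp⟩
    simp only [Finset.mem_filter, Finset.mem_powersetCard, Finset.subset_univ, true_and,
      Finset.card_smul_finset] at hC ⊢
    exact ⟨hC.1, by rw [Finset.subset_smul_finset_iff, inv_inv]; exact hC.2⟩
  · intro C _
    exact Sf_mono π C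

/-- The step `F_i Sf_k(n)` (`0 ≤ i ≤ k`) of the canonical filtration of `Sf_k(n)`: the span of
the elements `σ_k^n(A)` with `|A| = i`. -/
def SfFil (n i k : ℕ) : Subrepresentation (Sf n) where
  toSubmodule := Submodule.span ℚ {v | ∃ A : Finset (Fin n), A.card = i ∧ v = sigma k A}
  apply_mem_toSubmodule π v hv := by
    induction hv using Submodule.span_induction with
    | mem x hx =>
      obtain ⟨A, hA, rfl⟩ := hx
      rw [Sf_sigma]
      exact Submodule.subset_span ⟨π • A, by simpa using hA, rfl⟩
    | zero => simp
    | add x y _ _ hx hy => rw [map_add]; exact Submodule.add_mem _ hx hy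
    | smul a x _ hx => rw [map_smul]; exact Submodule.smul_mem _ a hx

/-! ### The direct sums -/

/-- The direct sum `V_(n) ⊕ V_(n-1,1) ⊕ … ⊕ V_(n-i,i)`, for `0 ≤ i ≤ ⌊n/2⌋`. -/
abbrev sumUpTo (n : ℕ) (i : Fin (n / 2 + 1)) :=
  Representation.directSum fun j : {j : Fin (n / 2 + 1) // j ≤ i} => V n j.1

/-- The direct sum of `n - 2k + 1` copies of `V_(n-k,k)` for each `k = 0, 1, …, ⌊n/2⌋`. -/
abbrev fullSum (n : ℕ) :=
  Representation.directSum fun p : (Σ k : Fin (n / 2 + 1), Fin (n - 2 * (k : ℕ) + 1)) => V n p.1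

end SqFree

end

/-! The monomials `mono A` form a basis of `SfAlg n`. Write E for multiplication by the sum of all
variables and D for `lower n`. Both commute with the symmetric group, and on degree k one has DE -
ED = n - 2k (`lower_genSum_mul_of_mem`), so they generate an action of sl₂. Let K_j be the kernel of
D in degree j (`prim Finset.univ j`). Then the algebra is the direct sum of the subspaces E^c K_j
with 2j ≤ n and c ≤ n - 2j, and E^c is injective on each such K_j. Spanning is
`homog_le_stringSpan`, together with `genSum_pow_mul_eq_zero` to discard the other powers;
independence is `iSupIndep_summand`, because the summands lie in distinct eigenspaces of `casimir`.

It remains to recognise K_j as the Specht module. Sending a tabloid to the monomial of its second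
row turns a polytabloid into a product of differences of variables over disjoint pairs
(`monoMap_polytabloid`), and these products span K_j (`prim_eq_pairSpan`). So each E^c K_j is a copy
of the Specht module, which gives the multiplicity n - 2j + 1.

Up to a nonzero factorial, the generators of the filtration are E^(k-i) `mono A`
(`genSum_pow_mul_mono`). Hence step i in degree k is E^(k-i) applied to degree i, the sum of the
E^(k-j) K_j with j ≤ i. -/

noncomputable section

namespace SqFree

variable {n : ℕ}

/-! ### The basis of square free monomials -/

/-- The exponent vector of the square free monomial `x_A`. -/
def expVec (A : Finset (Fin n)) : Fin n →₀ ℕ := ∑ a ∈ A, Finsupp.single a 1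

theorem expVec_apply (A : Finset (Fin n)) (i : Fin n) :
    expVec A i = if i ∈ A then 1 else 0 := by
  simp [expVec, Finsupp.finsetSum_apply, Finsupp.single_apply]

theorem expVec_injective : Function.Injective (expVec (n := n)) := by
  intro A B h
  ext i
  have := DFunLike.congr_fun h i
  simp only [expVec_apply] at this
  by_cases hA : i ∈ A <;> by_cases hB : i ∈ B <;> simp_all

theorem mono_eq_mk_monomial (A : Finset (Fin n)) :
    mono A = Ideal.Quotient.mk (sqIdeal n) (MvPolynomial.monomial (expVec A) 1) := by
  rw [mono, expVec, MvPolynomial.monomial_sum_one]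
  rfl

theorem mem_sqIdeal_iff (p : MvPolynomial (Fin n) ℚ) :
    p ∈ sqIdeal n ↔ ∀ m ∈ p.support, ∃ i, 2 ≤ m i := by
  have h : sqIdeal n = Ideal.span ((fun s => MvPolynomial.monomial s (1 : ℚ)) ''
      Set.range fun i : Fin n => Finsupp.single i 2) := by
    rw [sqIdeal, ← Set.range_comp]
    congr 1
    ext p
    simp [MvPolynomial.X_pow_eq_monomial]
  rw [h, MvPolynomial.mem_ideal_span_monomial_image]
  simp [Finsupp.single_le_iff]

/-- The coefficient of `x_A`, as a linear form on `Sf(n)`. -/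
def coeffForm (A : Finset (Fin n)) : SfAlg n →ₗ[ℚ] ℚ :=
  ((sqIdeal n).restrictScalars ℚ).liftQ (MvPolynomial.lcoeff ℚ (expVec A)) (by
    intro p hp
    have hp' := (mem_sqIdeal_iff p).1 hp
    rw [LinearMap.mem_ker, MvPolynomial.lcoeff_apply]
    by_contra hne
    obtain ⟨i, hi⟩ := hp' _ (MvPolynomial.mem_support_iff.2 hne)
    rw [expVec_apply] at hi
    split_ifs at hi <;> omega)

theorem coeffForm_mono (A B : Finset (Fin n)) :
    coeffForm A (mono B) = if B = A then 1 else 0 := by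
  rw [mono_eq_mk_monomial]
  change MvPolynomial.lcoeff ℚ (expVec A) (MvPolynomial.monomial (expVec B) 1) = _
  rw [MvPolynomial.lcoeff_apply, MvPolynomial.coeff_monomial]
  simp [expVec_injective.eq_iff]

/-- Reduction to square free form. The exponent identity in the second case is kept so that degrees
can be read off the support. -/
theorem mk_monomial (m : Fin n →₀ ℕ) (q : ℚ) :
    Ideal.Quotient.mk (sqIdeal n) (MvPolynomial.monomial m q) = 0 ∨
      (m = expVec m.support ∧
      Ideal.Quotient.mk (sqIdeal n) (MvPolynomial.monomial m q) = q • mono m.support) := by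
  by_cases h : ∃ i, 2 ≤ m i
  · left
    rw [Ideal.Quotient.eq_zero_iff_mem, mem_sqIdeal_iff]
    intro m' hm'
    rw [Finset.mem_singleton.1 (MvPolynomial.support_monomial_subset hm')]
    exact h
  · right
    push Not at h
    have hm : m = expVec m.support := by
      ext i
      rw [expVec_apply]
      have := h i
      split_ifs with hi
      · rw [Finsupp.mem_support_iff] at hi
        omega
      · simpa using hi
    refine ⟨hm, ?_⟩
    rw [mono_eq_mk_monomial, ← hm]
    have : MvPolynomial.monomial m q = q • MvPolynomial.monomial m (1 : ℚ) := by
      rw [MvPolynomial.smul_monomial, smul_eq_mul, mul_one]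
    rw [this]
    rfl

theorem linearIndependent_mono : LinearIndependent ℚ (mono (n := n)) := by
  rw [Fintype.linearIndependent_iff]
  intro g hg A
  have := congrArg (coeffForm A) hg
  simpa [map_sum, coeffForm_mono] using this

theorem span_mono : ⊤ ≤ Submodule.span ℚ (Set.range (mono (n := n))) := by
  rintro v -
  obtain ⟨p, rfl⟩ := Ideal.Quotient.mk_surjective v
  induction p using MvPolynomial.induction_on' with
  | monomial m q =>
    rcases mk_monomial m q with h | ⟨-, h⟩
    · rw [h]; exact Submodule.zero_mem _
    · rw [h]; exact Submodule.smul_mem _ _ (Submodule.subset_span ⟨_, rfl⟩)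
  | add p q hp hq => rw [map_add]; exact Submodule.add_mem _ hp hq

/-- The basis of `Sf(n)` given by the square free monomials. -/
def monoBasis (n : ℕ) : Module.Basis (Finset (Fin n)) ℚ (SfAlg n) :=
  Module.Basis.mk linearIndependent_mono span_mono

@[simp] theorem monoBasis_apply (A : Finset (Fin n)) : monoBasis n A = mono A := by
  simp [monoBasis]

theorem ext_mono {W : Type*} [AddCommGroup W] [Module ℚ W] {f g : SfAlg n →ₗ[ℚ] W}
    (h : ∀ A, f (mono A) = g (mono A)) : f = g :=
  (monoBasis n).ext fun A => by simpa using h A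

/-! ### Raising and lowering operators -/

/-- The generator `x_i` of `Sf(n)`. -/
def gen (i : Fin n) : SfAlg n := Ideal.Quotient.mk (sqIdeal n) (MvPolynomial.X i)

theorem mono_eq_prod (A : Finset (Fin n)) : mono A = ∏ a ∈ A, gen a := by
  rw [mono, map_prod]
  rfl

theorem gen_mul_self (i : Fin n) : gen i * gen i = 0 := by
  rw [gen, ← map_mul, Ideal.Quotient.eq_zero_iff_mem, ← pow_two]
  exact Ideal.subset_span ⟨i, rfl⟩

theorem gen_mul_mono_of_notMem {i : Fin n} {A : Finset (Fin n)} (h : i ∉ A) :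
    gen i * mono A = mono (insert i A) := by
  rw [mono_eq_prod, mono_eq_prod, Finset.prod_insert h]

theorem gen_mul_mono_of_mem {i : Fin n} {A : Finset (Fin n)} (h : i ∈ A) :
    gen i * mono A = 0 := by
  rw [mono_eq_prod, ← Finset.mul_prod_erase A _ h, ← mul_assoc, gen_mul_self, zero_mul]

@[simp] theorem mono_empty : mono (∅ : Finset (Fin n)) = 1 := by simp [mono_eq_prod]

/-- The partial derivative `∂/∂x_i`, on square free representatives. -/
def pd (i : Fin n) : SfAlg n →ₗ[ℚ] SfAlg n :=
  (monoBasis n).constr ℚ fun A => if i ∈ A then mono (A.erase i) else 0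

theorem pd_mono (i : Fin n) (A : Finset (Fin n)) :
    pd i (mono A) = if i ∈ A then mono (A.erase i) else 0 := by
  rw [← monoBasis_apply, pd, Module.Basis.constr_basis]

theorem pd_gen_mul_of_ne {i j : Fin n} (hij : i ≠ j) (v : SfAlg n) :
    pd j (gen i * v) = gen i * pd j v := by
  have : pd j ∘ₗ LinearMap.mulLeft ℚ (gen i) = LinearMap.mulLeft ℚ (gen i) ∘ₗ pd j := by
    refine ext_mono fun A => ?_
    simp only [LinearMap.comp_apply, LinearMap.mulLeft_apply, pd_mono]
    by_cases hi : i ∈ A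
    · rw [gen_mul_mono_of_mem hi]
      split_ifs
      · rw [gen_mul_mono_of_mem (by simp [hij, hi]), map_zero]
      · simp
    · rw [gen_mul_mono_of_notMem hi, pd_mono]
      split_ifs with h1 h2 h2
      · rw [gen_mul_mono_of_notMem (by simp [hi]), Finset.erase_insert_of_ne hij]
      · simp [hij.symm, h2] at h1
      · simp [h2] at h1
      · simp
  exact LinearMap.congr_fun this v

/-- The minus sign shows that `pd i` is not a derivation: either `v`'s monomial contains i and is
killed by `gen i`, or it does not and is killed by `pd i`. -/
theorem pd_gen_mul_self (i : Fin n) (v : SfAlg n) :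
    pd i (gen i * v) = v - gen i * pd i v := by
  have : pd i ∘ₗ LinearMap.mulLeft ℚ (gen i) =
      LinearMap.id - LinearMap.mulLeft ℚ (gen i) ∘ₗ pd i := by
    refine ext_mono fun A => ?_
    simp only [LinearMap.comp_apply, LinearMap.mulLeft_apply, LinearMap.sub_apply,
      LinearMap.id_apply, pd_mono]
    by_cases hi : i ∈ A
    · rw [gen_mul_mono_of_mem hi, if_pos hi, gen_mul_mono_of_notMem (by simp),
        Finset.insert_erase hi]
      simp
    · rw [gen_mul_mono_of_notMem hi, if_neg hi, pd_mono, if_pos (by simp),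
        Finset.erase_insert hi]
      simp
  exact LinearMap.congr_fun this v

/-- The lowering operator `∑ ∂/∂x_i`. -/
def lower (n : ℕ) : SfAlg n →ₗ[ℚ] SfAlg n := ∑ i, pd i

theorem lower_apply (v : SfAlg n) : lower n v = ∑ i, pd i v := by
  simp [lower]

theorem lower_mono (A : Finset (Fin n)) : lower n (mono A) = ∑ i ∈ A, mono (A.erase i) := by
  simp [lower_apply, pd_mono]

/-- The sum of the variables indexed by `S`. -/
def genSum (S : Finset (Fin n)) : SfAlg n := ∑ i ∈ S, gen i

/-- Only the term j = i of the sum fails to commute with `gen i`; it turns `gen i * pd i v` into `v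
- gen i * pd i v`, whence the factor 2. -/
theorem lower_gen_mul (i : Fin n) (v : SfAlg n) :
    lower n (gen i * v) = gen i * lower n v + v - (2 : ℚ) • (gen i * pd i v) := by
  rw [lower_apply, lower_apply, ← Finset.add_sum_erase _ _ (Finset.mem_univ i),
    ← Finset.add_sum_erase _ _ (Finset.mem_univ i), pd_gen_mul_self,
    Finset.sum_congr rfl fun j hj => pd_gen_mul_of_ne (Finset.ne_of_mem_erase hj).symm v,
    ← Finset.mul_sum, two_smul]
  ring

theorem lower_genSum_mul (S : Finset (Fin n)) (v : SfAlg n) :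
    lower n (genSum S * v) = genSum S * lower n v + (S.card : ℚ) • v -
      (2 : ℚ) • ∑ i ∈ S, gen i * pd i v := by
  rw [genSum, Finset.sum_mul, map_sum, Finset.sum_congr rfl fun i _ => lower_gen_mul i v,
    Finset.sum_sub_distrib, Finset.sum_add_distrib, Finset.sum_const, Finset.sum_mul,
    Finset.smul_sum, Nat.cast_smul_eq_nsmul]

/-! ### Homogeneous components and the sl₂ relation -/

/-- The span of the square free monomials of degree `k` in the variables indexed by `S`. -/
def homog (S : Finset (Fin n)) (k : ℕ) : Submodule ℚ (SfAlg n) :=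
  Submodule.span ℚ {v | ∃ A : Finset (Fin n), A ⊆ S ∧ A.card = k ∧ v = mono A}

theorem mono_mem_homog {S A : Finset (Fin n)} (hA : A ⊆ S) : mono A ∈ homog S A.card :=
  Submodule.subset_span ⟨A, hA, rfl, rfl⟩

/-- To prove that a linear map sends `homog S k` into a submodule, it is enough to look at the
monomials. -/
theorem homog_le_comap {W : Type*} [AddCommGroup W] [Module ℚ W] {S : Finset (Fin n)} {k : ℕ}
    {f : SfAlg n →ₗ[ℚ] W} {N : Submodule ℚ W}
    (h : ∀ A ⊆ S, A.card = k → f (mono A) ∈ N) : homog S k ≤ N.comap f := by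
  rw [homog, Submodule.span_le]
  rintro _ ⟨A, hA, hk, rfl⟩
  exact h A hA hk

theorem homog_eqOn {W : Type*} [AddCommGroup W] [Module ℚ W] {S : Finset (Fin n)} {k : ℕ}
    {f g : SfAlg n →ₗ[ℚ] W} (h : ∀ A ⊆ S, A.card = k → f (mono A) = g (mono A))
    {v : SfAlg n} (hv : v ∈ homog S k) : f v = g v := by
  have := homog_le_comap (f := f - g) (N := ⊥) (S := S) (k := k)
    (fun A hA hk => by simp [h A hA hk]) hv
  simpa [sub_eq_zero] using this

theorem homog_mono {S T : Finset (Fin n)} (h : S ⊆ T) (k : ℕ) : homog S k ≤ homog T k :=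
  Submodule.span_mono fun _ ⟨A, hA, hk, hv⟩ => ⟨A, hA.trans h, hk, hv⟩

theorem gen_mul_mem_homog {S : Finset (Fin n)} {i : Fin n} (hi : i ∈ S) {k : ℕ} {v : SfAlg n}
    (hv : v ∈ homog S k) : gen i * v ∈ homog S (k + 1) := by
  refine homog_le_comap (f := LinearMap.mulLeft ℚ (gen i)) (N := homog S (k + 1)) (fun A hA hk => ?_) hv
  rw [LinearMap.mulLeft_apply]
  by_cases h : i ∈ A
  · rw [gen_mul_mono_of_mem h]
    exact Submodule.zero_mem _
  · rw [gen_mul_mono_of_notMem h, ← hk, ← Finset.card_insert_of_notMem h]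
    exact mono_mem_homog (Finset.insert_subset hi hA)

theorem genSum_mul_mem_homog {S : Finset (Fin n)} {k : ℕ} {v : SfAlg n}
    (hv : v ∈ homog S k) : genSum S * v ∈ homog S (k + 1) := by
  rw [genSum, Finset.sum_mul]
  exact Submodule.sum_mem _ fun i hi => gen_mul_mem_homog hi hv

theorem genSum_pow_mul_mem_homog {S : Finset (Fin n)} {k : ℕ} {v : SfAlg n}
    (hv : v ∈ homog S k) (m : ℕ) : genSum S ^ m * v ∈ homog S (k + m) := by
  induction m with
  | zero => simpa using hv
  | succ m ih =>
    rw [pow_succ', mul_assoc]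
    exact genSum_mul_mem_homog ih

theorem lower_mem_homog {S : Finset (Fin n)} {k : ℕ} {v : SfAlg n}
    (hv : v ∈ homog S (k + 1)) : lower n v ∈ homog S k := by
  refine homog_le_comap (f := lower n) (N := homog S k) (fun A hA hk => ?_) hv
  rw [lower_mono]
  refine Submodule.sum_mem _ fun i hi => ?_
  have : k = (A.erase i).card := by rw [Finset.card_erase_of_mem hi]; omega
  rw [this]
  exact mono_mem_homog ((Finset.erase_subset _ _).trans hA)

/-- Euler's identity: `gen i * pd i` projects onto the monomials containing i, so each `mono A` is
counted |A| times. -/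
theorem sum_gen_mul_pd {S : Finset (Fin n)} {k : ℕ} {v : SfAlg n} (hv : v ∈ homog S k) :
    ∑ i ∈ S, gen i * pd i v = (k : ℚ) • v := by
  have := homog_eqOn (f := ∑ i ∈ S, LinearMap.mulLeft ℚ (gen i) ∘ₗ pd i)
    (g := (k : ℚ) • LinearMap.id) (S := S) (k := k) (fun A hA hk => ?_) hv
  · simpa using this
  · simp only [LinearMap.sum_apply, LinearMap.comp_apply, LinearMap.mulLeft_apply, pd_mono,
      LinearMap.smul_apply, LinearMap.id_apply]
    have h1 : ∀ i ∈ S, gen i * (if i ∈ A then mono (A.erase i) else 0) =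
        if i ∈ A then mono A else 0 := by
      intro i _
      split_ifs with hi
      · rw [gen_mul_mono_of_notMem (by simp), Finset.insert_erase hi]
      · simp
    rw [Finset.sum_congr rfl h1, Finset.sum_ite_mem, Finset.inter_eq_right.2 hA,
      Finset.sum_const, hk, Nat.cast_smul_eq_nsmul]

theorem lower_genSum_mul_of_mem {S : Finset (Fin n)} {k : ℕ} {v : SfAlg n}
    (hv : v ∈ homog S k) :
    lower n (genSum S * v) = genSum S * lower n v + ((S.card : ℚ) - 2 * k) • v := by
  rw [lower_genSum_mul, sum_gen_mul_pd hv]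
  module

/-- Each commutation past a factor contributes |S| - 2(k + t), for t = 0, …, m; the scalar is the
sum of these. -/
theorem lower_genSum_pow_mul {S : Finset (Fin n)} {k : ℕ} {v : SfAlg n}
    (hv : v ∈ homog S k) (hD : lower n v = 0) (m : ℕ) :
    lower n (genSum S ^ (m + 1) * v) =
      (((m : ℚ) + 1) * ((S.card : ℚ) - 2 * k - m)) • (genSum S ^ m * v) := by
  induction m with
  | zero => simp [lower_genSum_mul_of_mem hv, hD]
  | succ m ih =>
    rw [pow_succ', mul_assoc, lower_genSum_mul_of_mem (genSum_pow_mul_mem_homog hv _), ih,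
      mul_smul_comm, ← mul_assoc, ← pow_succ']
    rw [← add_smul]
    congr 1
    push_cast
    ring

theorem isNilpotent_genSum (S : Finset (Fin n)) : IsNilpotent (genSum S) := by
  rw [← mem_nilradical]
  refine Ideal.sum_mem _ fun i _ => ?_
  rw [mem_nilradical]
  exact ⟨2, by rw [pow_two, gen_mul_self]⟩

/-! ### Primitive vectors -/

/-- The kernel of the lowering operator on `homog S k`. -/
def prim (S : Finset (Fin n)) (k : ℕ) : Submodule ℚ (SfAlg n) :=
  homog S k ⊓ LinearMap.ker (lower n)

theorem mem_prim {S : Finset (Fin n)} {k : ℕ} {v : SfAlg n} :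
    v ∈ prim S k ↔ v ∈ homog S k ∧ lower n v = 0 := Iff.rfl

/-- Applying `lower n` strips one power of `genSum S` at the cost of a scalar, nonzero by `hm`. -/
theorem eq_zero_of_genSum_pow_mul {S : Finset (Fin n)} {k : ℕ} {v : SfAlg n}
    (hv : v ∈ prim S k) {m : ℕ}
    (hm : ∀ i < m, (S.card : ℚ) - 2 * k - i ≠ 0) (h : genSum S ^ m * v = 0) : v = 0 := by
  induction m with
  | zero => simpa using h
  | succ m ih =>
    refine ih (fun i hi => hm i (by omega)) ?_
    have := lower_genSum_pow_mul hv.1 hv.2 m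
    rw [h, map_zero, eq_comm, smul_eq_zero] at this
    refine this.resolve_left (mul_ne_zero (by positivity) (hm m (by omega)))

/-- Beyond the middle degree all the scalars |S| - 2k - i are negative, so nilpotency of `genSum S`
forces v = 0. -/
theorem prim_eq_bot {S : Finset (Fin n)} {k : ℕ} (hk : S.card < 2 * k) : prim S k = ⊥ := by
  rw [eq_bot_iff]
  intro v hv
  obtain ⟨m, hm⟩ := isNilpotent_genSum S
  refine eq_zero_of_genSum_pow_mul hv (m := m) (fun i _ => ?_) (by rw [hm, zero_mul])
  have h1 : (S.card : ℚ) < 2 * k := by exact_mod_cast hk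
  have h2 : (0 : ℚ) ≤ i := by positivity
  intro h
  linarith

theorem pd_eq_zero {S : Finset (Fin n)} {k : ℕ} {v : SfAlg n} (hv : v ∈ homog S k) {i : Fin n}
    (hi : i ∉ S) : pd i v = 0 := by
  refine homog_eqOn (f := pd i) (g := 0) (fun A hA _ => ?_) hv
  rw [pd_mono, if_neg fun h => hi (hA h), LinearMap.zero_apply]

theorem lower_gen_mul_of_notMem {S : Finset (Fin n)} {k : ℕ} {v : SfAlg n} (hv : v ∈ homog S k)
    {i : Fin n} (hi : i ∉ S) : lower n (gen i * v) = gen i * lower n v + v := by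
  rw [lower_gen_mul, pd_eq_zero hv hi, mul_zero, smul_zero, sub_zero]

theorem one_mem_homog (S : Finset (Fin n)) : (1 : SfAlg n) ∈ homog S 0 :=
  Submodule.subset_span ⟨∅, Finset.empty_subset S, Finset.card_empty, mono_empty.symm⟩

theorem lower_of_mem_homog_zero {S : Finset (Fin n)} {v : SfAlg n} (hv : v ∈ homog S 0) :
    lower n v = 0 := by
  refine homog_eqOn (f := lower n) (g := 0) (fun A _ hk => ?_) hv
  rw [Finset.card_eq_zero.1 hk, lower_mono]
  simp

theorem homog_zero (S : Finset (Fin n)) : homog S 0 = Submodule.span ℚ {1} := by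
  refine le_antisymm ?_ ?_
  · rw [homog, Submodule.span_le]
    rintro _ ⟨A, -, hk, rfl⟩
    rw [Finset.card_eq_zero.1 hk, mono_empty]
    exact Submodule.mem_span_singleton_self _
  · rw [Submodule.span_le, Set.singleton_subset_iff]
    exact one_mem_homog S

/-! ### Products of differences span the primitive vectors -/

/-- `ι` lists `k` disjoint ordered pairs of elements of `S`. -/
def IsPairing (S : Finset (Fin n)) {k : ℕ} (ι : Fin k → Bool → Fin n) : Prop :=
  (∀ i j ε δ, ι i ε = ι j δ → i = j ∧ ε = δ) ∧ ∀ i ε, ι i ε ∈ S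

/-- The product of the differences `x_b - x_a` over the pairs `(a, b)` listed by `ι`. -/
def pairProd {k : ℕ} (ι : Fin k → Bool → Fin n) : SfAlg n :=
  ∏ i, (gen (ι i true) - gen (ι i false))

/-- The two variables of the first factor do not occur in the others, so there the lowering operator
obeys the Leibniz rule, and it sends the difference to 1 - 1 = 0. -/
theorem pairProd_mem_prim {k : ℕ} {S : Finset (Fin n)} {ι : Fin k → Bool → Fin n}
    (h : IsPairing S ι) : pairProd ι ∈ prim S k := by
  induction k generalizing S with
  | zero =>
    rw [pairProd, Fin.prod_univ_zero]
    exact ⟨one_mem_homog S, lower_of_mem_homog_zero (one_mem_homog S)⟩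
  | succ k ih =>
    have h' : IsPairing ((S.erase (ι 0 true)).erase (ι 0 false)) (fun i => ι i.succ) := by
      refine ⟨fun i j ε δ hij => ?_, fun i ε => ?_⟩
      · simpa using h.1 _ _ _ _ hij
      · refine Finset.mem_erase.2 ⟨fun hc => ?_, Finset.mem_erase.2 ⟨fun hc => ?_, h.2 _ _⟩⟩
        · exact Fin.succ_ne_zero i (h.1 _ _ _ _ hc).1
        · exact Fin.succ_ne_zero i (h.1 _ _ _ _ hc).1
    obtain ⟨h1, h2⟩ := mem_prim.1 (ih h')
    have h3 := homog_mono ((Finset.erase_subset _ _).trans (Finset.erase_subset _ S)) k h1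
    rw [pairProd, Fin.prod_univ_succ, sub_mul]
    refine mem_prim.2 ⟨Submodule.sub_mem _ (gen_mul_mem_homog (h.2 _ _) h3)
      (gen_mul_mem_homog (h.2 _ _) h3), ?_⟩
    change lower n (gen _ * pairProd _ - gen _ * pairProd _) = 0
    rw [map_sub, lower_gen_mul_of_notMem h1 (by simp), lower_gen_mul_of_notMem h1 (by simp), h2]
    simp

/-- The span of the products of `k` differences over disjoint pairs in `S`. -/
def pairSpan (S : Finset (Fin n)) (k : ℕ) : Submodule ℚ (SfAlg n) :=
  Submodule.span ℚ {v | ∃ ι : Fin k → Bool → Fin n, IsPairing S ι ∧ v = pairProd ι}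

theorem pairSpan_le_prim (S : Finset (Fin n)) (k : ℕ) : pairSpan S k ≤ prim S k := by
  rw [pairSpan, Submodule.span_le]
  rintro _ ⟨ι, h, rfl⟩
  exact pairProd_mem_prim h

theorem pairSpan_mono {S T : Finset (Fin n)} (h : S ⊆ T) (k : ℕ) : pairSpan S k ≤ pairSpan T k :=
  Submodule.span_mono fun _ ⟨ι, hι, hv⟩ => ⟨ι, ⟨hι.1, fun i ε => h (hι.2 i ε)⟩, hv⟩

theorem IsPairing.exists_notMem {S : Finset (Fin n)} {k : ℕ} {ι : Fin k → Bool → Fin n}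
    (hS : 2 * k < S.card) : ∃ d ∈ S, ∀ i ε, ι i ε ≠ d := by
  obtain ⟨d, hd, hd'⟩ := Finset.exists_mem_notMem_of_card_lt_card
    (s := Finset.univ.image fun p : Fin k × Bool => ι p.1 p.2) (t := S)
    (Finset.card_image_le.trans_lt (by simpa [mul_comm] using hS))
  exact ⟨d, hd, fun i ε h => hd' (Finset.mem_image.2 ⟨(i, ε), Finset.mem_univ _, h⟩)⟩

theorem IsPairing.cons {S : Finset (Fin n)} {k : ℕ} {ι : Fin k → Bool → Fin n}
    (h : IsPairing S ι) {c d : Fin n} (hc : c ∉ S) (hd : d ∈ S) (hd' : ∀ i ε, ι i ε ≠ d) :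
    IsPairing (insert c S)
      (Fin.cons (fun ε => if ε then c else d) ι : Fin (k + 1) → Bool → Fin n) := by
  have hcd : c ≠ d := fun h => hc (h ▸ hd)
  have hc' : ∀ i ε, ι i ε ≠ c := fun i ε hi => hc (hi ▸ h.2 i ε)
  refine ⟨fun i j ε δ => ?_, fun i ε => ?_⟩
  · refine Fin.cases ?_ (fun i => ?_) i <;> refine Fin.cases ?_ (fun j => ?_) j
    · cases ε <;> cases δ <;> simp [hcd, hcd.symm]
    · cases ε <;> simp [(hd' _ _).symm, (hc' _ _).symm]
    · cases δ <;> simp [hd', hc']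
    · simpa using h.1 i j ε δ
  · refine Fin.cases ?_ (fun i => ?_) i
    · cases ε <;> simp [hd]
    · simpa using Or.inr (h.2 i ε)

theorem exists_eq_add_gen_mul {S : Finset (Fin n)} {c : Fin n} {k : ℕ}
    {v : SfAlg n} (hv : v ∈ homog (insert c S) (k + 1)) :
    ∃ v₀ ∈ homog S (k + 1), ∃ v₁ ∈ homog S k, v = v₀ + gen c * v₁ := by
  induction hv using Submodule.span_induction with
  | mem v hv =>
    obtain ⟨A, hA, hk, rfl⟩ := hv
    by_cases h : c ∈ A
    · refine ⟨0, Submodule.zero_mem _, mono (A.erase c), ?_, ?_⟩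
      · have : k = (A.erase c).card := by rw [Finset.card_erase_of_mem h]; omega
        rw [this]
        exact mono_mem_homog (Finset.subset_insert_iff.1 hA)
      · rw [gen_mul_mono_of_notMem (by simp), Finset.insert_erase h, zero_add]
    · refine ⟨mono A, ?_, 0, Submodule.zero_mem _, by simp⟩
      rw [← hk]
      exact mono_mem_homog ((Finset.subset_insert_iff_of_notMem h).1 hA)
  | zero => exact ⟨0, Submodule.zero_mem _, 0, Submodule.zero_mem _, by simp⟩
  | add v w _ _ hv hw =>
    obtain ⟨v₀, h0, v₁, h1, rfl⟩ := hv
    obtain ⟨w₀, g0, w₁, g1, rfl⟩ := hw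
    exact ⟨_, Submodule.add_mem _ h0 g0, _, Submodule.add_mem _ h1 g1, by ring⟩
  | smul a v _ hv =>
    obtain ⟨v₀, h0, v₁, h1, rfl⟩ := hv
    exact ⟨_, Submodule.smul_mem _ a h0, _, Submodule.smul_mem _ a h1, by
      rw [smul_add, mul_smul_comm]⟩

/-- A product p of k differences leaves some d in S unused, and x_c p = (x_c - x_d) p + x_d p. -/
theorem gen_mul_mem_sup {S : Finset (Fin n)} {c : Fin n} (hc : c ∉ S) {k : ℕ}
    (hS : 2 * k < S.card) {v : SfAlg n} (hv : v ∈ pairSpan S k) :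
    gen c * v ∈ pairSpan (insert c S) (k + 1) ⊔ homog S (k + 1) := by
  suffices h : pairSpan S k ≤ (pairSpan (insert c S) (k + 1) ⊔ homog S (k + 1)).comap
      (LinearMap.mulLeft ℚ (gen c)) from h hv
  rw [pairSpan, Submodule.span_le]
  rintro _ ⟨ι, hι, rfl⟩
  obtain ⟨d, hd, hd'⟩ := IsPairing.exists_notMem (ι := ι) hS
  have : gen c * pairProd ι =
      pairProd (Fin.cons (fun ε => if ε then c else d) ι : Fin (k + 1) → Bool → Fin n) +
        gen d * pairProd ι := by
    rw [pairProd, pairProd, Fin.prod_univ_succ]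
    simp only [Fin.cons_zero, Fin.cons_succ, if_true, Bool.false_eq_true, if_false]
    ring
  rw [SetLike.mem_coe, Submodule.mem_comap, LinearMap.mulLeft_apply, this]
  exact Submodule.add_mem_sup (Submodule.subset_span ⟨_, hι.cons hc hd hd', rfl⟩)
    (gen_mul_mem_homog hd (pairProd_mem_prim hι).1)

/-- Induction on S. In v = v₀ + x_c v₁ the factor v₁ is again primitive, hence in `pairSpan S k`. Up
to an element of `homog S (k + 1)`, x_c v₁ is then a combination of products of differences;
subtracting that combination from v leaves a primitive vector not involving c. -/
theorem prim_le_pairSpan (S : Finset (Fin n)) (k : ℕ) : prim S k ≤ pairSpan S k := by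
  induction S using Finset.induction_on generalizing k with
  | empty =>
    cases k with
    | zero =>
      refine inf_le_left.trans ?_
      rw [homog_zero, Submodule.span_le, Set.singleton_subset_iff]
      exact Submodule.subset_span ⟨Fin.elim0, ⟨fun i => i.elim0, fun i => i.elim0⟩, by
        simp [pairProd]⟩
    | succ k => rw [prim_eq_bot (by simp)]; exact bot_le
  | insert c S hc ih =>
    cases k with
    | zero =>
      refine inf_le_left.trans ?_
      rw [homog_zero, Submodule.span_le, Set.singleton_subset_iff]
      exact Submodule.subset_span ⟨Fin.elim0, ⟨fun i => i.elim0, fun i => i.elim0⟩, by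
        simp [pairProd]⟩
    | succ k =>
      rcases lt_or_ge (insert c S).card (2 * (k + 1)) with hlt | hge
      · rw [prim_eq_bot hlt]; exact bot_le
      rw [Finset.card_insert_of_notMem hc] at hge
      intro v hvD
      obtain ⟨hv, hD⟩ := mem_prim.1 hvD
      obtain ⟨v₀, h0, v₁, h1, rfl⟩ := exists_eq_add_gen_mul hv
      -- Here D v = D v₀ + x_c D v₁ + v₁, and D v₁ is the coefficient of x_c, which `pd c` extracts.
      have hD1 : lower n v₁ = 0 := by
        rw [map_add, lower_gen_mul_of_notMem h1 hc] at hD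
        have := congrArg (pd c) hD
        rw [map_add, map_add, map_zero, pd_gen_mul_self, pd_eq_zero (lower_mem_homog h0) hc,
          pd_eq_zero h1 hc] at this
        cases k with
        | zero => exact lower_of_mem_homog_zero h1
        | succ k => simpa [pd_eq_zero (lower_mem_homog h1) hc] using this
      obtain ⟨p, hp, w, hw, hpw⟩ := Submodule.mem_sup.1
        (gen_mul_mem_sup hc (by omega) (ih k (mem_prim.2 ⟨h1, hD1⟩)))
      rw [← hpw] at hD ⊢
      have hDp := (mem_prim.1 (pairSpan_le_prim _ _ hp)).2
      have h2 : v₀ + w ∈ prim S (k + 1) := by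
        refine mem_prim.2 ⟨Submodule.add_mem _ h0 hw, ?_⟩
        rw [map_add, map_add, hDp, zero_add] at hD
        rw [map_add, hD]
      rw [add_left_comm]
      exact Submodule.add_mem _ hp (pairSpan_mono (Finset.subset_insert c S) _ (ih _ h2))

theorem prim_eq_pairSpan (S : Finset (Fin n)) (k : ℕ) : prim S k = pairSpan S k :=
  le_antisymm (prim_le_pairSpan S k) (pairSpan_le_prim S k)

/-! ### Generation by strings -/

/-- The span of the elements `(∑ x_i)^c v` with `v` of degree `j` killed by the lowering
operator and `j + c = k`. -/
def stringSpan (n k : ℕ) : Submodule ℚ (SfAlg n) :=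
  Submodule.span ℚ {w | ∃ j c, j + c = k ∧ ∃ v ∈ prim (Finset.univ : Finset (Fin n)) j,
    w = genSum Finset.univ ^ c * v}

theorem pow_mul_mem_stringSpan {j : ℕ} {v : SfAlg n} (hv : v ∈ prim Finset.univ j) (c : ℕ) :
    genSum Finset.univ ^ c * v ∈ stringSpan n (j + c) :=
  Submodule.subset_span ⟨j, c, rfl, v, hv, rfl⟩

theorem mem_stringSpan_of_mem_prim {k : ℕ} {v : SfAlg n} (hv : v ∈ prim Finset.univ k) :
    v ∈ stringSpan n k := by
  simpa using pow_mul_mem_stringSpan hv 0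

theorem genSum_mul_mem_stringSpan {k : ℕ} {v : SfAlg n} (hv : v ∈ stringSpan n k) :
    genSum Finset.univ * v ∈ stringSpan n (k + 1) := by
  suffices h : stringSpan n k ≤ (stringSpan n (k + 1)).comap
      (LinearMap.mulLeft ℚ (genSum Finset.univ)) from h hv
  rw [stringSpan, Submodule.span_le]
  rintro _ ⟨j, c, rfl, v, hv, rfl⟩
  rw [SetLike.mem_coe, Submodule.mem_comap, LinearMap.mulLeft_apply, ← mul_assoc, ← pow_succ',
    add_assoc]
  exact pow_mul_mem_stringSpan hv (c + 1)

theorem stringSpan_le_homog (k : ℕ) : stringSpan n k ≤ homog Finset.univ k := by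
  rw [stringSpan, Submodule.span_le]
  rintro _ ⟨j, c, rfl, v, hv, rfl⟩
  exact genSum_pow_mul_mem_homog (mem_prim.1 hv).1 c

/-- DE multiplies E^c v by (c + 1)(n - 2j - c), which is positive below the middle degree, so DE can
be inverted on each string. -/
theorem exists_lower_genSum_mul_eq {k : ℕ} (hk : 2 * k < n) {z : SfAlg n}
    (hz : z ∈ stringSpan n k) :
    ∃ w ∈ stringSpan n k, lower n (genSum Finset.univ * w) = z := by
  suffices h : stringSpan n k ≤ (stringSpan n k).map
      (lower n ∘ₗ LinearMap.mulLeft ℚ (genSum Finset.univ)) from h hz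
  conv_lhs => rw [stringSpan]
  rw [Submodule.span_le]
  rintro _ ⟨j, c, rfl, v, hv, rfl⟩
  have hne : ((c : ℚ) + 1) * (((Finset.univ : Finset (Fin n)).card : ℚ) - 2 * j - c) ≠ 0 := by
    have : (2 * (j + c) : ℚ) < n := by exact_mod_cast hk
    rw [Finset.card_univ, Fintype.card_fin]
    have hc : (0 : ℚ) ≤ c := by positivity
    have : (0 : ℚ) < n - 2 * j - c := by linarith
    positivity
  refine ⟨(((c : ℚ) + 1) * (((Finset.univ : Finset (Fin n)).card : ℚ) - 2 * j - c))⁻¹ •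
    (genSum Finset.univ ^ c * v), Submodule.smul_mem _ _ (pow_mul_mem_stringSpan hv c), ?_⟩
  rw [map_smul, LinearMap.comp_apply, LinearMap.mulLeft_apply, ← mul_assoc, ← pow_succ',
    lower_genSum_pow_mul (mem_prim.1 hv).1 (mem_prim.1 hv).2, smul_smul, inv_mul_cancel₀ hne,
    one_smul]

/-- Choose w one degree lower with D E w = D v; then v - E w is primitive and E w lies in the string
span. -/
theorem homog_le_stringSpan_of_le {k : ℕ} (hk : 2 * k ≤ n + 1) :
    homog Finset.univ k ≤ stringSpan n k := by
  induction k with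
  | zero =>
    intro v hv
    exact mem_stringSpan_of_mem_prim (mem_prim.2 ⟨hv, lower_of_mem_homog_zero hv⟩)
  | succ k ih =>
    intro v hv
    obtain ⟨w, hw, hwv⟩ := exists_lower_genSum_mul_eq (by omega)
      (ih (by omega) (lower_mem_homog hv))
    rw [← sub_add_cancel v (genSum Finset.univ * w)]
    refine Submodule.add_mem _ (mem_stringSpan_of_mem_prim (mem_prim.2 ⟨?_, ?_⟩))
      (genSum_mul_mem_stringSpan hw)
    · exact Submodule.sub_mem _ hv (genSum_mul_mem_homog (stringSpan_le_homog _ hw))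
    · rw [map_sub, hwv, sub_self]

/-! ### Complementation and the upper degrees -/

/-- The linear map of `Sf(n)` sending `x_A` to `x_B`, where `B` is the complement of `A`. -/
def complMap (n : ℕ) : SfAlg n →ₗ[ℚ] SfAlg n := (monoBasis n).constr ℚ fun A => mono Aᶜ

theorem complMap_mono (A : Finset (Fin n)) : complMap n (mono A) = mono Aᶜ := by
  rw [← monoBasis_apply, complMap, Module.Basis.constr_basis]

theorem complMap_complMap (v : SfAlg n) : complMap n (complMap n v) = v := by
  have : complMap n ∘ₗ complMap n = LinearMap.id :=
    ext_mono fun A => by simp [complMap_mono]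
  exact LinearMap.congr_fun this v

theorem complMap_mem_homog {k : ℕ} {v : SfAlg n} (hv : v ∈ homog Finset.univ k) :
    complMap n v ∈ homog Finset.univ (n - k) := by
  refine homog_le_comap (f := complMap n) (N := homog Finset.univ (n - k)) (fun A _ hk => ?_) hv
  rw [complMap_mono]
  exact Submodule.subset_span ⟨Aᶜ, Finset.subset_univ _, by
    rw [Finset.card_compl, Fintype.card_fin, hk], rfl⟩

theorem genSum_mul_mono (S A : Finset (Fin n)) :
    genSum S * mono A = ∑ i ∈ S \ A, mono (insert i A) := by
  rw [genSum, Finset.sum_mul, ← Finset.sum_sdiff (Finset.inter_subset_left (s₁ := S) (s₂ := A)),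
    Finset.sdiff_inter_self_left, Finset.sum_congr rfl fun i hi =>
      gen_mul_mono_of_notMem (Finset.mem_sdiff.1 hi).2,
    Finset.sum_eq_zero (s := S ∩ A) fun i hi => gen_mul_mono_of_mem (Finset.mem_inter.1 hi).2,
    add_zero]

/-- Removing an element from A adds it to the complement, so complementation exchanges D and E. -/
theorem complMap_lower (v : SfAlg n) :
    complMap n (lower n v) = genSum Finset.univ * complMap n v := by
  have : complMap n ∘ₗ lower n = LinearMap.mulLeft ℚ (genSum Finset.univ) ∘ₗ complMap n := by
    refine ext_mono fun A => ?_
    rw [LinearMap.comp_apply, LinearMap.comp_apply, LinearMap.mulLeft_apply, lower_mono,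
      complMap_mono, genSum_mul_mono, map_sum, ← Finset.compl_eq_univ_sdiff, compl_compl]
    exact Finset.sum_congr rfl fun i _ => by rw [complMap_mono, Finset.compl_erase]
  exact LinearMap.congr_fun this v

theorem homog_le_stringSpan (k : ℕ) : homog Finset.univ k ≤ stringSpan n k := by
  induction k with
  | zero => exact homog_le_stringSpan_of_le (by omega)
  | succ k ih =>
    by_cases hk : 2 * (k + 1) ≤ n + 1
    · exact homog_le_stringSpan_of_le hk
    by_cases hkn : k + 1 ≤ n
    · intro v hv
      -- The complement of v lies below the middle degree, so it equals D E w; complementing back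
      -- writes v as E applied to the complement of E w, which has degree k.
      obtain ⟨w, hw, hwv⟩ := exists_lower_genSum_mul_eq (k := n - (k + 1)) (by omega)
        (homog_le_stringSpan_of_le (by omega) (complMap_mem_homog hv))
      rw [← complMap_complMap v, ← hwv, complMap_lower]
      refine genSum_mul_mem_stringSpan (ih ?_)
      have := complMap_mem_homog (genSum_mul_mem_homog (stringSpan_le_homog _ hw))
      rwa [show n - (n - (k + 1) + 1) = k by omega] at this
    · rw [homog, Submodule.span_le]
      rintro _ ⟨A, -, hA, -⟩
      have := Finset.card_le_univ A
      rw [Fintype.card_fin] at this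
      omega

/-- At power n - 2j + 1 the scalar in `lower_genSum_pow_mul` vanishes, so the vector is primitive of
degree n - j + 1, above the middle, and must be zero. -/
theorem genSum_pow_mul_eq_zero {j c : ℕ} (hj : 2 * j ≤ n) (hc : n < 2 * j + c) {v : SfAlg n}
    (hv : v ∈ prim Finset.univ j) : genSum Finset.univ ^ c * v = 0 := by
  obtain ⟨d, rfl⟩ : ∃ d, c = d + (n - 2 * j + 1) := ⟨c - (n - 2 * j + 1), by omega⟩
  have h : genSum Finset.univ ^ (n - 2 * j + 1) * v ∈
      prim Finset.univ (j + (n - 2 * j + 1)) := by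
    refine mem_prim.2 ⟨genSum_pow_mul_mem_homog (mem_prim.1 hv).1 _, ?_⟩
    rw [lower_genSum_pow_mul (mem_prim.1 hv).1 (mem_prim.1 hv).2, Finset.card_univ,
      Fintype.card_fin, Nat.cast_sub hj]
    simp
  rw [prim_eq_bot (by rw [Finset.card_univ, Fintype.card_fin]; omega), Submodule.mem_bot] at h
  rw [pow_add, mul_assoc, h, mul_zero]

/-! ### The direct sum decomposition -/

/-- The indices `(j, c)` of the summands of `fullSum n`. -/
abbrev Idx (n : ℕ) : Type := Σ k : Fin (n / 2 + 1), Fin (n - 2 * (k : ℕ) + 1)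

/-- The summand `(∑ x_i)^c K_j`, where `K_j` is the kernel of the lowering operator in
degree `j`. -/
def summand (p : Idx n) : Submodule ℚ (SfAlg n) :=
  (prim Finset.univ (p.1 : ℕ)).map (LinearMap.mulLeft ℚ (genSum Finset.univ ^ (p.2 : ℕ)))

theorem mem_iSup_summand {j c : ℕ} {v : SfAlg n} (hv : v ∈ prim Finset.univ j) {P : Idx n → Prop}
    (hP : ∀ p : Idx n, (p.1 : ℕ) = j → (p.2 : ℕ) = c → P p) :
    genSum Finset.univ ^ c * v ∈ ⨆ p : {p : Idx n // P p}, summand p.1 := by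
  by_cases hj : 2 * j ≤ n
  · by_cases hc : 2 * j + c ≤ n
    · let p : Idx n := ⟨⟨j, by omega⟩, ⟨c, by simp only; omega⟩⟩
      exact Submodule.mem_iSup_of_mem ⟨p, hP p rfl rfl⟩ ⟨v, hv, rfl⟩
    · rw [genSum_pow_mul_eq_zero hj (by omega) hv]
      exact Submodule.zero_mem _
  · rw [prim_eq_bot (by rw [Finset.card_univ, Fintype.card_fin]; omega), Submodule.mem_bot] at hv
    rw [hv, mul_zero]
    exact Submodule.zero_mem _

theorem homog_le_iSup_summand (k : ℕ) :
    homog Finset.univ k ≤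
      ⨆ p : {p : Idx n // (p.1 : ℕ) + (p.2 : ℕ) = k}, summand p.1 := by
  refine (homog_le_stringSpan k).trans ?_
  rw [stringSpan, Submodule.span_le]
  rintro _ ⟨j, c, rfl, v, hv, rfl⟩
  exact mem_iSup_summand hv fun p h1 h2 => congrArg₂ (· + ·) h1 h2

theorem summand_le_homog (p : Idx n) : summand p ≤ homog Finset.univ ((p.1 : ℕ) + (p.2 : ℕ)) := by
  rintro _ ⟨v, hv, rfl⟩
  exact genSum_pow_mul_mem_homog (mem_prim.1 hv).1 _

theorem iSup_summand : ⨆ p : Idx n, summand p = ⊤ := by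
  rw [eq_top_iff]
  refine span_mono.trans ?_
  rw [Submodule.span_le]
  rintro _ ⟨A, rfl⟩
  have h : ⨆ p : {p : Idx n // (p.1 : ℕ) + (p.2 : ℕ) = A.card}, summand p.1 ≤
      ⨆ p : Idx n, summand p := iSup_le fun p => le_iSup summand p.1
  exact h (homog_le_iSup_summand _ (mono_mem_homog (Finset.subset_univ A)))

/-- An operator which separates the summands. -/
def casimir (n : ℕ) : SfAlg n →ₗ[ℚ] SfAlg n :=
  LinearMap.mulLeft ℚ (genSum Finset.univ) ∘ₗ lower n +
    (((n + 1) ^ 2 : ℕ) : ℚ) • ∑ i, LinearMap.mulLeft ℚ (gen i) ∘ₗ pd i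

/-- The eigenvalue of `casimir` on `summand p`. -/
def casimirValue (p : Idx n) : ℕ :=
  (p.2 : ℕ) * (n - 2 * (p.1 : ℕ) - p.2 + 1) + (n + 1) ^ 2 * ((p.1 : ℕ) + p.2)

/-- ED acts on E^c K_j by c(n - 2j - c + 1), and the Euler operator by the degree j + c. -/
theorem casimir_apply_of_mem {p : Idx n} {w : SfAlg n} (hw : w ∈ summand p) :
    casimir n w = (casimirValue p : ℚ) • w := by
  have hw' := sum_gen_mul_pd (summand_le_homog p hw)
  obtain ⟨v, hv, rfl⟩ := hw
  obtain ⟨⟨j, hj⟩, ⟨c, hc⟩⟩ := p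
  simp only at hv hw' hc
  rw [LinearMap.mulLeft_apply] at hw' ⊢
  have h1 : lower n (genSum Finset.univ ^ c * v) * genSum Finset.univ =
      ((c : ℚ) * ((n : ℚ) - 2 * j - c + 1)) • (genSum Finset.univ ^ c * v) := by
    cases c with
    | zero => simp [(mem_prim.1 hv).2]
    | succ c =>
      rw [lower_genSum_pow_mul (mem_prim.1 hv).1 (mem_prim.1 hv).2, smul_mul_assoc, mul_right_comm,
        ← pow_succ, Finset.card_univ, Fintype.card_fin]
      congr 1
      push_cast
      ring
  have h2 : (casimirValue (⟨⟨j, hj⟩, ⟨c, hc⟩⟩ : Idx n) : ℚ) =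
      (c : ℚ) * ((n : ℚ) - 2 * j - c + 1) + (((n + 1) ^ 2 : ℕ) : ℚ) * ((j + c : ℕ) : ℚ) := by
    simp only [casimirValue]
    push_cast
    rw [Nat.cast_sub (by omega), Nat.cast_sub (by omega)]
    push_cast
    ring
  rw [h2, add_smul, ← h1, mul_smul, ← hw']
  simp [casimir, mul_comm]

/-- The weight (n + 1)² exceeds every eigenvalue of ED, so quotient and remainder recover the degree
and that eigenvalue; in a fixed degree the latter determines j. -/
theorem casimirValue_injective : Function.Injective (casimirValue (n := n)) := by
  -- With d = n - 2j - c and j + c fixed, raising j lowers both c and d.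
  have key : ∀ j c d j' c' d' : ℕ, 2 * j + c + d = n → 2 * j' + c' + d' = n →
      j + c = j' + c' → j < j' → c * (d + 1) ≠ c' * (d' + 1) := by
    intro j c d j' c' d' h1 h2 h3 h4 h5
    have : c' * (d' + 1) < c * (d + 1) := Nat.mul_lt_mul'' (by omega) (by omega)
    omega
  have bound : ∀ p : Idx n, (p.2 : ℕ) * (n - 2 * (p.1 : ℕ) - p.2 + 1) < (n + 1) ^ 2 := by
    intro p
    have hp := p.2.2
    calc (p.2 : ℕ) * (n - 2 * (p.1 : ℕ) - p.2 + 1) ≤ n * (n + 1) :=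
          Nat.mul_le_mul (by omega) (by omega)
      _ < (n + 1) ^ 2 := by nlinarith
  intro p q h
  have hd : (p.1 : ℕ) + p.2 = q.1 + q.2 := by
    have := congrArg (· / (n + 1) ^ 2) h
    simp only [casimirValue] at this
    rwa [Nat.add_mul_div_left _ _ (by positivity), Nat.add_mul_div_left _ _ (by positivity),
      Nat.div_eq_of_lt (bound p), Nat.div_eq_of_lt (bound q), zero_add, zero_add] at this
  have he : (p.2 : ℕ) * (n - 2 * (p.1 : ℕ) - p.2 + 1) =
      q.2 * (n - 2 * (q.1 : ℕ) - q.2 + 1) := by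
    simp only [casimirValue, hd] at h
    omega
  obtain ⟨⟨j, hj⟩, ⟨c, hc⟩⟩ := p
  obtain ⟨⟨j', hj'⟩, ⟨c', hc'⟩⟩ := q
  simp only at hd he hc hc'
  have hjj : j = j' := by
    rcases lt_trichotomy j j' with hlt | heq | hgt
    · exact absurd he (key j c _ j' c' _ (by omega) (by omega) hd hlt)
    · exact heq
    · exact absurd he.symm (key j' c' _ j c _ (by omega) (by omega) hd.symm hgt)
  subst hjj
  obtain rfl : c = c' := by omega
  rfl

theorem iSupIndep_summand : iSupIndep (summand (n := n)) := by
  have h := (Module.End.eigenspaces_iSupIndep (casimir n)).comp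
    (f := fun p : Idx n => (casimirValue p : ℚ))
    (fun p q h => casimirValue_injective (Nat.cast_injective h))
  refine h.mono fun p w hw => ?_
  exact Module.End.mem_eigenspace_iff.2 (casimir_apply_of_mem hw)

theorem genSum_pow_mul_injOn {p : Idx n} {v : SfAlg n} (hv : v ∈ prim Finset.univ (p.1 : ℕ))
    (h : genSum Finset.univ ^ (p.2 : ℕ) * v = 0) : v = 0 := by
  refine eq_zero_of_genSum_pow_mul hv (fun i hi hi' => ?_) h
  rw [Finset.card_univ, Fintype.card_fin, sub_sub, sub_eq_zero] at hi'
  have h1 : n = 2 * (p.1 : ℕ) + i := by exact_mod_cast hi'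
  have := p.2.2
  omega

/-! ### Isomorphisms from equivariant embeddings in a common module -/

section Equivalences

variable {k G X Y W : Type*} [Field k] [Group G] [AddCommGroup X] [Module k X]
  [AddCommGroup Y] [Module k Y] [AddCommGroup W] [Module k W]
  {ρ : Representation k G X} {σ : Representation k G Y} {τ : Representation k G W}

theorem nonempty_equiv_of_range_eq (f : X →ₗ[k] W) (g : Y →ₗ[k] W)
    (hf : Function.Injective f) (hg : Function.Injective g)
    (hρ : ∀ a x, f (ρ a x) = τ a (f x)) (hσ : ∀ a y, g (σ a y) = τ a (g y))
    (h : LinearMap.range f = LinearMap.range g) : Nonempty (ρ.Equiv σ) := by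
  let e : X ≃ₗ[k] Y := (LinearEquiv.ofInjective f hf).trans
    ((LinearEquiv.ofEq _ _ h).trans (LinearEquiv.ofInjective g hg).symm)
  have he : ∀ x, g (e x) = f x := fun x =>
    congrArg Subtype.val ((LinearEquiv.ofInjective g hg).apply_symm_apply
      (LinearEquiv.ofEq _ _ h (LinearEquiv.ofInjective f hf x)))
  refine ⟨Representation.Equiv.mk e fun a => LinearMap.ext fun x => hg ?_⟩
  simp only [LinearMap.comp_apply, LinearEquiv.coe_coe]
  rw [he, hρ, hσ, he]

open scoped DirectSum

variable {ι : Type*} [DecidableEq ι] {V : ι → Type*} [∀ i, AddCommGroup (V i)]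
  [∀ i, Module k (V i)] {φ : ∀ i, Representation k G (V i)}

theorem range_toModule (f : ∀ i, V i →ₗ[k] W) :
    LinearMap.range (DirectSum.toModule k ι W f) = ⨆ i, LinearMap.range (f i) := by
  refine le_antisymm ?_ (iSup_le fun i => ?_)
  · rintro _ ⟨x, rfl⟩
    induction x using DirectSum.induction_on with
    | zero => rw [map_zero]; exact Submodule.zero_mem _
    | of i x =>
      rw [← DirectSum.lof_eq_of k, DirectSum.toModule_lof]
      exact Submodule.mem_iSup_of_mem i ⟨x, rfl⟩
    | add x y hx hy => rw [map_add]; exact Submodule.add_mem _ hx hy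
  · rintro _ ⟨x, rfl⟩
    exact ⟨DirectSum.lof k ι V i x, DirectSum.toModule_lof k i x⟩

/-- The map factors through the direct sum of the ranges, where independence applies. -/
theorem toModule_injective (f : ∀ i, V i →ₗ[k] W) (hf : ∀ i, Function.Injective (f i))
    (h : iSupIndep fun i => LinearMap.range (f i)) :
    Function.Injective (DirectSum.toModule k ι W f) := by
  have h1 : DirectSum.toModule k ι W f =
      DirectSum.toModule k ι W (fun i => (LinearMap.range (f i)).subtype) ∘ₗ
        DirectSum.lmap (fun i => (f i).rangeRestrict) := by
    refine DirectSum.linearMap_ext k fun i => LinearMap.ext fun x => ?_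
    simp
  have h2 : Function.Injective
      (DirectSum.toModule k ι W fun i => (LinearMap.range (f i)).subtype) :=
    h.dfinsupp_lsum_injective
  have h3 : Function.Injective (DirectSum.lmap fun i => (f i).rangeRestrict) :=
    (DirectSum.lmap_injective _).2 fun i a b hab =>
      hf i (congrArg (LinearMap.range (f i)).subtype hab)
  rw [h1, LinearMap.coe_comp]
  exact h2.comp h3

theorem nonempty_equiv_directSum (g : X →ₗ[k] W) (hg : Function.Injective g)
    (hρ : ∀ a x, g (ρ a x) = τ a (g x)) (f : ∀ i, V i →ₗ[k] W)
    (hf : ∀ i, Function.Injective (f i)) (hφ : ∀ i a v, f i (φ i a v) = τ a (f i v))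
    (hind : iSupIndep fun i => LinearMap.range (f i))
    (h : LinearMap.range g = ⨆ i, LinearMap.range (f i)) :
    Nonempty (ρ.Equiv (Representation.directSum φ)) := by
  refine nonempty_equiv_of_range_eq (τ := τ) g (DirectSum.toModule k ι W f) hg
    (toModule_injective f hf hind) hρ (fun a x => ?_) (h.trans (range_toModule f).symm)
  change DirectSum.toModule k ι W f (DirectSum.lmap (fun i => φ i a) x) = _
  induction x using DirectSum.induction_on with
  | zero => simp
  | of i x =>
    rw [← DirectSum.lof_eq_of k, DirectSum.lmap_lof, DirectSum.toModule_lof,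
      DirectSum.toModule_lof, hφ]
  | add x y hx hy => rw [map_add, map_add, map_add, map_add, hx, hy]

end Equivalences


/-! ### Permutation modules inside the square free algebra -/

section Linearization

variable {H : Type*}

/-- The linear map sending the basis vector `h` to the square free monomial `x_{s h}`. -/
def monoMap (s : H → Finset (Fin n)) : MonoidAlgebra ℚ H →ₗ[ℚ] SfAlg n :=
  Finsupp.linearCombination ℚ (fun h => mono (s h)) ∘ₗ
    (MonoidAlgebra.coeffLinearEquiv ℚ).toLinearMap

theorem monoMap_single (s : H → Finset (Fin n)) (h : H) (q : ℚ) :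
    monoMap s (MonoidAlgebra.single h q) = q • mono (s h) := by
  simp [monoMap]

theorem monoMap_injective {s : H → Finset (Fin n)} (hs : Function.Injective s) :
    Function.Injective (monoMap s) :=
  Function.Injective.comp (g := Finsupp.linearCombination ℚ (fun h => mono (s h)))
    (linearIndependent_mono.comp s hs)
    (MonoidAlgebra.coeffLinearEquiv ℚ).injective

theorem monoMap_ofMulAction [MulAction (Equiv.Perm (Fin n)) H] {s : H → Finset (Fin n)}
    (hs : ∀ (π : Equiv.Perm (Fin n)) h, s (π • h) = π • s h) (π : Equiv.Perm (Fin n))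
    (v : MonoidAlgebra ℚ H) :
    monoMap s (Representation.ofMulAction ℚ (Equiv.Perm (Fin n)) H π v) =
      Sf n π (monoMap s v) := by
  induction v using MonoidAlgebra.induction_linear with
  | zero => simp
  | add x y hx hy => rw [map_add, map_add, map_add, map_add, hx, hy]
  | single h q => rw [Representation.ofMulAction_single, monoMap_single, monoMap_single, map_smul,
      Sf_mono, hs]

theorem range_monoMap_id : LinearMap.range (monoMap (id : Finset (Fin n) → Finset (Fin n))) = ⊤ := by
  rw [eq_top_iff]
  refine span_mono.trans ?_
  rw [Submodule.span_le]
  rintro _ ⟨A, rfl⟩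
  exact ⟨MonoidAlgebra.single A 1, by rw [monoMap_single, one_smul, id]⟩

end Linearization

/-! ### Equivariance of the operators -/

theorem Sf_mul (π : Equiv.Perm (Fin n)) (v w : SfAlg n) : Sf n π (v * w) = Sf n π v * Sf n π w :=
  map_mul (sfMap n π) v w

theorem Sf_gen (π : Equiv.Perm (Fin n)) (i : Fin n) : Sf n π (gen i) = gen (π i) := by
  rw [gen, Sf_mk, MvPolynomial.rename_X, gen]

theorem Sf_genSum_univ (π : Equiv.Perm (Fin n)) :
    Sf n π (genSum Finset.univ) = genSum Finset.univ := by
  rw [genSum, map_sum, Finset.sum_congr rfl fun i _ => Sf_gen π i]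
  exact Equiv.sum_comp π gen

theorem Sf_genSum_pow_mul (π : Equiv.Perm (Fin n)) (c : ℕ) (v : SfAlg n) :
    Sf n π (genSum Finset.univ ^ c * v) = genSum Finset.univ ^ c * Sf n π v := by
  induction c with
  | zero => simp
  | succ c ih => rw [pow_succ', mul_assoc, Sf_mul, Sf_genSum_univ, ih, mul_assoc]

theorem Sf_complMap (π : Equiv.Perm (Fin n)) (v : SfAlg n) :
    complMap n (Sf n π v) = Sf n π (complMap n v) := by
  have : complMap n ∘ₗ Sf n π = Sf n π ∘ₗ complMap n := by
    refine ext_mono fun A => ?_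
    simp only [LinearMap.comp_apply, Sf_mono, complMap_mono]
    congr 1
    ext x
    rw [Finset.mem_compl, ← Finset.inv_smul_mem_iff, ← Finset.inv_smul_mem_iff, Finset.mem_compl]
  exact LinearMap.congr_fun this v

/-! ### Graded pieces and the canonical filtration -/

theorem SfHom_toSubmodule (k : ℕ) : (SfHom n k).toSubmodule = homog Finset.univ k := by
  refine le_antisymm ?_ ?_
  · rintro _ ⟨p, hp, rfl⟩
    rw [SetLike.mem_coe, MvPolynomial.mem_homogeneousSubmodule] at hp
    rw [MvPolynomial.as_sum p, map_sum]
    refine Submodule.sum_mem _ fun m hm => ?_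
    have hdeg := hp (MvPolynomial.mem_support_iff.1 hm)
    change Ideal.Quotient.mk (sqIdeal n) _ ∈ _
    rcases mk_monomial m (MvPolynomial.coeff m p) with h | ⟨h1, h⟩
    · rw [h]; exact Submodule.zero_mem _
    · rw [h]
      refine Submodule.smul_mem _ _ (Submodule.subset_span ⟨_, Finset.subset_univ _, ?_, rfl⟩)
      rw [← hdeg, Finsupp.weight_apply, Finsupp.sum]
      simp only [Pi.one_apply, smul_eq_mul, mul_one]
      rw [Finset.card_eq_sum_ones]
      refine Finset.sum_congr rfl fun i hi => ?_
      rw [h1, expVec_apply, if_pos hi]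
  · rw [homog, Submodule.span_le]
    rintro _ ⟨A, -, rfl, rfl⟩
    refine ⟨∏ a ∈ A, MvPolynomial.X a, ?_, rfl⟩
    rw [SetLike.mem_coe, MvPolynomial.mem_homogeneousSubmodule]
    simpa using MvPolynomial.IsHomogeneous.prod A (fun a => MvPolynomial.X (R := ℚ) a)
      (fun _ => 1) fun a _ => MvPolynomial.isHomogeneous_X ℚ a

theorem sigma_card (A : Finset (Fin n)) : sigma A.card A = mono A := by
  have : (Finset.powersetCard A.card Finset.univ).filter (A ⊆ ·) = {A} := by
    ext C
    simp only [Finset.mem_filter, Finset.mem_powersetCard, Finset.subset_univ, true_and,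
      Finset.mem_singleton]
    exact ⟨fun h => (Finset.eq_of_subset_of_card_le h.2 h.1.le).symm, fun h => by simp [h]⟩
  rw [sigma, this, Finset.sum_singleton]

/-- Double counting: each larger C containing A arises once for every element of C \ A, that is, m +
1 times. -/
theorem genSum_mul_sigma (m : ℕ) (A : Finset (Fin n)) :
    genSum Finset.univ * sigma (A.card + m) A = ((m : ℚ) + 1) • sigma (A.card + (m + 1)) A := by
  have h : ((m : ℚ) + 1) • sigma (A.card + (m + 1)) A =
      ∑ C ∈ (Finset.powersetCard (A.card + (m + 1)) Finset.univ).filter (A ⊆ ·),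
        ∑ _i ∈ C \ A, mono C := by
    rw [sigma, Finset.smul_sum]
    refine Finset.sum_congr rfl fun C hC => ?_
    simp only [Finset.mem_filter, Finset.mem_powersetCard, Finset.subset_univ, true_and] at hC
    rw [Finset.sum_const, Finset.card_sdiff_of_subset hC.2, hC.1, ← Nat.cast_smul_eq_nsmul ℚ,
      Nat.add_sub_cancel_left]
    push_cast
    rfl
  rw [h, sigma, Finset.mul_sum, Finset.sum_congr rfl fun C _ => genSum_mul_mono Finset.univ C,
    Finset.sum_sigma', Finset.sum_sigma']
  refine Finset.sum_bij' (fun p _ => ⟨insert p.2 p.1, p.2⟩) (fun p _ => ⟨p.1.erase p.2, p.2⟩)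
    ?_ ?_ ?_ ?_ ?_
  · rintro ⟨C, i⟩ hp
    simp only [Finset.mem_sigma, Finset.mem_filter, Finset.mem_powersetCard, Finset.subset_univ,
      true_and, Finset.mem_sdiff, Finset.mem_univ] at hp ⊢
    obtain ⟨⟨h1, h2⟩, h3⟩ := hp
    exact ⟨⟨by rw [Finset.card_insert_of_notMem h3]; omega,
      h2.trans (Finset.subset_insert _ _)⟩, Finset.mem_insert_self _ _, fun h => h3 (h2 h)⟩
  · rintro ⟨C, i⟩ hp
    simp only [Finset.mem_sigma, Finset.mem_filter, Finset.mem_powersetCard, Finset.subset_univ,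
      true_and, Finset.mem_sdiff, Finset.mem_univ] at hp ⊢
    obtain ⟨⟨h1, h2⟩, h3, h4⟩ := hp
    exact ⟨⟨by rw [Finset.card_erase_of_mem h3]; omega,
      Finset.subset_erase.2 ⟨h2, h4⟩⟩, by simp⟩
  · rintro ⟨C, i⟩ hp
    simp only [Finset.mem_sigma, Finset.mem_sdiff, Finset.mem_univ, true_and] at hp
    simp [Finset.erase_insert hp.2]
  · rintro ⟨C, i⟩ hp
    simp only [Finset.mem_sigma, Finset.mem_sdiff] at hp
    simp [Finset.insert_erase hp.2.1]
  · rintro ⟨C, i⟩ _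
    rfl

theorem genSum_pow_mul_mono (A : Finset (Fin n)) (m : ℕ) :
    genSum Finset.univ ^ m * mono A = (m.factorial : ℚ) • sigma (A.card + m) A := by
  induction m with
  | zero => simp [sigma_card]
  | succ m ih =>
    rw [pow_succ', mul_assoc, ih, mul_smul_comm, genSum_mul_sigma, smul_smul, Nat.factorial_succ]
    congr 1
    push_cast
    ring

/-- By `genSum_pow_mul_mono` the spanning elements are E^(k-i) `mono A` divided by (k - i)!, which
is invertible over ℚ. -/
theorem SfFil_toSubmodule {i k : ℕ} (hik : i ≤ k) : (SfFil n i k).toSubmodule =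
    (homog Finset.univ i).map (LinearMap.mulLeft ℚ (genSum Finset.univ ^ (k - i))) := by
  obtain ⟨m, rfl⟩ := Nat.exists_eq_add_of_le hik
  rw [Nat.add_sub_cancel_left]
  refine le_antisymm ?_ ?_
  · refine Submodule.span_le.2 ?_
    rintro _ ⟨A, rfl, rfl⟩
    refine ⟨(m.factorial : ℚ)⁻¹ • mono A,
      Submodule.smul_mem _ _ (mono_mem_homog (Finset.subset_univ A)), ?_⟩
    rw [map_smul, LinearMap.mulLeft_apply, genSum_pow_mul_mono, smul_smul,
      inv_mul_cancel₀ (by exact_mod_cast m.factorial_ne_zero), one_smul]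
  · rw [Submodule.map_le_iff_le_comap]
    refine homog_le_comap (f := LinearMap.mulLeft ℚ (genSum Finset.univ ^ m))
      (N := (SfFil n i (i + m)).toSubmodule) fun A _ hA => ?_
    subst hA
    rw [LinearMap.mulLeft_apply, genSum_pow_mul_mono]
    exact Submodule.smul_mem _ _ (Submodule.subset_span ⟨A, rfl, rfl⟩)

theorem SfFil_self (k : ℕ) : SfFil n k k = SfHom n k := by
  refine Subrepresentation.toSubmodule_injective ?_
  rw [SfFil_toSubmodule le_rfl, SfHom_toSubmodule, Nat.sub_self, pow_zero, LinearMap.mulLeft_one,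
    Submodule.map_id]

/-- E^(k-i) carries E^(i-j) K_j to E^(k-j) K_j. Since k ≤ n/2, the exponent k - j stays within the
range allowed by `Idx n`. -/
theorem SfFil_toSubmodule_eq_iSup (i k : Fin (n / 2 + 1)) (hik : i ≤ k) :
    (SfFil n i k).toSubmodule = ⨆ j : {j : Fin (n / 2 + 1) // j ≤ i},
      summand (⟨j.1, ⟨(k : ℕ) - j.1, by omega⟩⟩ : Idx n) := by
  rw [SfFil_toSubmodule hik]
  have hik' : (i : ℕ) ≤ k := hik
  refine le_antisymm ?_ (iSup_le fun j => ?_)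
  · rw [Submodule.map_le_iff_le_comap]
    refine (homog_le_stringSpan _).trans ?_
    rw [stringSpan, Submodule.span_le]
    rintro _ ⟨j, c, hjc, v, hv, rfl⟩
    rw [SetLike.mem_coe, Submodule.mem_comap, LinearMap.mulLeft_apply, ← mul_assoc, ← pow_add]
    refine Submodule.mem_iSup_of_mem ⟨⟨j, by omega⟩, Fin.le_def.2 (by simp only; omega)⟩
      ⟨v, hv, ?_⟩
    rw [LinearMap.mulLeft_apply]
    congr 2
    simp only
    omega
  · obtain ⟨j, hj⟩ := j
    have hj' : (j : ℕ) ≤ i := hj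
    rintro _ ⟨v, hv, rfl⟩
    refine ⟨genSum Finset.univ ^ ((i : ℕ) - j) * v, ?_, ?_⟩
    · have := genSum_pow_mul_mem_homog (mem_prim.1 hv).1 ((i : ℕ) - j)
      rwa [show ((⟨j, ⟨(k : ℕ) - j, by omega⟩⟩ : Idx n).1 : ℕ) + ((i : ℕ) - j) = i by
        simp only; omega] at this
    · rw [LinearMap.mulLeft_apply, LinearMap.mulLeft_apply, ← mul_assoc, ← pow_add]
      congr 2
      simp only
      omega

/-! ### Two-row tableaux and Specht modules -/

variable {k : Fin (n / 2 + 1)}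

theorem mem_twoRow {c : ℕ × ℕ} :
    c ∈ twoRow n k ↔ c.1 = 0 ∧ c.2 < n - k ∨ c.1 = 1 ∧ c.2 < k := by
  obtain ⟨i, j⟩ := c
  rw [twoRow, YoungDiagram.mem_ofRowLens]
  match i with
  | 0 => simp
  | 1 => simp
  | i + 2 => simp

theorem card_cells_twoRow : Fintype.card (twoRow n k).cells = n := by
  have : (twoRow n k).cells =
      ({0} ×ˢ Finset.range (n - k)) ∪ ({1} ×ˢ Finset.range k) := by
    ext ⟨i, j⟩
    rw [YoungDiagram.mem_cells, mem_twoRow]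
    simp [and_comm, eq_comm]
  rw [Fintype.card_coe, this, Finset.card_union_of_disjoint]
  · simp only [Finset.card_product, Finset.card_singleton, Finset.card_range, one_mul]
    omega
  · rw [Finset.disjoint_left]
    rintro ⟨i, j⟩ h1 h2
    simp only [Finset.mem_product, Finset.mem_singleton] at h1 h2
    omega

theorem Tabloid.row_eq (T : Tabloid n (twoRow n k)) (x : Fin n) : T.1 x = 0 ∨ T.1 x = 1 := by
  have h1 : 0 < (twoRow n k).rowLen (T.1 x) := by
    rw [← T.2 (T.1 x)]
    exact Finset.card_pos.2 ⟨x, by simp⟩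
  rw [← YoungDiagram.mem_iff_lt_rowLen, mem_twoRow] at h1
  tauto

/-- The entries of the second row of a tabloid. -/
def Tabloid.secondRow {μ : YoungDiagram} (T : Tabloid n μ) : Finset (Fin n) :=
  Finset.univ.filter fun x => T.1 x = 1

theorem Tabloid.secondRow_injective :
    Function.Injective (Tabloid.secondRow (n := n) (μ := twoRow n k)) := by
  intro T U h
  refine Subtype.ext (funext fun x => ?_)
  have hx : T.1 x = 1 ↔ U.1 x = 1 := by
    simpa [Tabloid.secondRow] using Finset.ext_iff.1 h x
  rcases T.row_eq x with h1 | h1 <;> rcases U.row_eq x with h2 | h2 <;> simp_all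

theorem Tabloid.secondRow_smul {μ : YoungDiagram} (π : Equiv.Perm (Fin n)) (T : Tabloid n μ) :
    (π • T).secondRow = π • T.secondRow := by
  ext x
  rw [← Finset.inv_smul_mem_iff, Tabloid.secondRow, Tabloid.secondRow, Finset.mem_filter,
    Finset.mem_filter]
  simp only [Finset.mem_univ, true_and]
  rfl

/-- The pairs of entries in the columns of length two of a tableau. -/
def Tableau.pairs (t : Tableau n (twoRow n k)) (i : Fin k) (ε : Bool) : Fin n :=
  t.symm ⟨(if ε then 1 else 0, i), by
    have := i.2
    have := k.2
    rw [YoungDiagram.mem_cells, mem_twoRow]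
    cases ε
    · simp only [Bool.false_eq_true, if_false, true_and, zero_ne_one, false_and, or_false]
      omega
    · simp⟩

theorem Tableau.apply_pairs (t : Tableau n (twoRow n k)) (i : Fin k) (ε : Bool) :
    (t (t.pairs i ε)).1 = (if ε then 1 else 0, (i : ℕ)) := by
  rw [Tableau.pairs, Equiv.apply_symm_apply]

theorem Tableau.isPairing_pairs (t : Tableau n (twoRow n k)) :
    IsPairing Finset.univ t.pairs := by
  refine ⟨fun i j ε δ h => ?_, fun i ε => Finset.mem_univ _⟩
  have := congrArg (fun x => (t x).1) h
  simp only [Tableau.apply_pairs, Prod.mk.injEq] at this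
  refine ⟨Fin.ext this.2, ?_⟩
  cases ε <;> cases δ <;> simp_all

theorem Tableau.eq_pairs (t : Tableau n (twoRow n k)) {x : Fin n} {i : Fin k}
    (h : (t x).1.2 = i) : x = t.pairs i true ∨ x = t.pairs i false := by
  have hx := (t x).2
  rw [YoungDiagram.mem_cells, mem_twoRow] at hx
  rcases hx with ⟨hx, -⟩ | ⟨hx, -⟩
  · right
    refine t.injective (Subtype.ext ?_)
    rw [Tableau.apply_pairs]
    exact Prod.ext hx h
  · left
    refine t.injective (Subtype.ext ?_)
    rw [Tableau.apply_pairs]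
    exact Prod.ext hx h

theorem Tableau.eq_of_column_eq (t : Tableau n (twoRow n k)) {x y : Fin n}
    (hx : (k : ℕ) ≤ (t x).1.2) (h : (t y).1.2 = (t x).1.2) : y = x := by
  have h1 := (t x).2
  have h2 := (t y).2
  rw [YoungDiagram.mem_cells, mem_twoRow] at h1 h2
  exact t.injective (Subtype.ext (Prod.ext (by omega) h))

theorem Tableau.secondRow_tabloid (t : Tableau n (twoRow n k)) :
    t.tabloid.secondRow = Finset.univ.image fun i => t.pairs i true := by
  ext x
  simp only [Tabloid.secondRow, Finset.mem_filter, Finset.mem_univ, true_and, Finset.mem_image]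
  constructor
  · intro (h : (t x).1.1 = 1)
    have hx := (t x).2
    rw [YoungDiagram.mem_cells, mem_twoRow] at hx
    have hlt : (t x).1.2 < k := by omega
    refine ⟨⟨_, hlt⟩, t.injective (Subtype.ext ?_)⟩
    rw [Tableau.apply_pairs]
    exact Prod.ext h.symm rfl
  · rintro ⟨i, rfl⟩
    change (t _).1.1 = 1
    rw [Tableau.apply_pairs]
    rfl

theorem Tableau.mono_smul_secondRow (t : Tableau n (twoRow n k)) (σ : Equiv.Perm (Fin n)) :
    mono (σ • t.tabloid.secondRow) = ∏ i, gen (σ (t.pairs i true)) := by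
  rw [t.secondRow_tabloid, mono_eq_prod, Finset.smul_finset_def,
    Finset.prod_image (fun x _ y _ h => by simpa using h),
    Finset.prod_image (fun i _ j _ h => (t.isPairing_pairs.1 _ _ _ _ h).1)]
  rfl

/-- The columns of length two of a tableau, as an embedding. -/
def Tableau.pairsEmb (t : Tableau n (twoRow n k)) : Fin k × Bool ↪ Fin n where
  toFun p := t.pairs p.1 p.2
  inj' _ _ h := Prod.ext_iff.2 (t.isPairing_pairs.1 _ _ _ _ h)

/-- The column permutation acting on the `i`-th column of length two by `g i`. -/
def Tableau.columnPerm (t : Tableau n (twoRow n k)) (g : Fin k → Equiv.Perm Bool) :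
    Equiv.Perm (Fin n) :=
  Equiv.Perm.viaFintypeEmbedding (Equiv.prodCongrRight g) t.pairsEmb

theorem Tableau.columnPerm_pairs (t : Tableau n (twoRow n k)) (g : Fin k → Equiv.Perm Bool)
    (i : Fin k) (ε : Bool) : t.columnPerm g (t.pairs i ε) = t.pairs i (g i ε) :=
  Equiv.Perm.viaFintypeEmbedding_apply_image (Equiv.prodCongrRight g : Equiv.Perm (Fin k × Bool))
    t.pairsEmb (i, ε)

theorem Tableau.columnPerm_of_le (t : Tableau n (twoRow n k)) (g : Fin k → Equiv.Perm Bool)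
    {x : Fin n} (hx : (k : ℕ) ≤ (t x).1.2) : t.columnPerm g x = x := by
  refine Equiv.Perm.viaFintypeEmbedding_apply_notMem_range (Equiv.prodCongrRight g)
    t.pairsEmb ?_
  rintro ⟨⟨i, ε⟩, rfl⟩
  change (k : ℕ) ≤ (t (t.pairs i ε)).1.2 at hx
  rw [Tableau.apply_pairs] at hx
  exact absurd i.2 (not_lt.2 hx)

theorem Tableau.sign_columnPerm (t : Tableau n (twoRow n k)) (g : Fin k → Equiv.Perm Bool) :
    Equiv.Perm.sign (t.columnPerm g) = ∏ i, Equiv.Perm.sign (g i) := by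
  rw [Tableau.columnPerm, Equiv.Perm.viaFintypeEmbedding_sign, Equiv.Perm.sign_prodCongrRight]

theorem Tableau.columnPerm_mem (t : Tableau n (twoRow n k)) (g : Fin k → Equiv.Perm Bool) :
    t.columnPerm g ∈ t.columnStabilizer := by
  refine Finset.mem_filter.2 ⟨Finset.mem_univ _, fun x => ?_⟩
  rcases lt_or_ge (t x).1.2 (k : ℕ) with h | h
  · rcases t.eq_pairs (i := ⟨_, h⟩) rfl with hx | hx
    all_goals
      rw [hx, t.columnPerm_pairs, t.apply_pairs, t.apply_pairs]
  · rw [t.columnPerm_of_le g h]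

theorem Tableau.columnPerm_injective (t : Tableau n (twoRow n k)) :
    Function.Injective t.columnPerm := by
  intro g h hgh
  funext i
  ext1 ε
  have := DFunLike.congr_fun hgh (t.pairs i ε)
  rw [t.columnPerm_pairs, t.columnPerm_pairs] at this
  exact (t.isPairing_pairs.1 _ _ _ _ this).2

/-- A column permutation fixes the entries of the columns of length one and either fixes or swaps
each pair. -/
theorem Tableau.exists_columnPerm_eq (t : Tableau n (twoRow n k)) {σ : Equiv.Perm (Fin n)}
    (hσ : σ ∈ t.columnStabilizer) : ∃ g, t.columnPerm g = σ := by
  have hcol : ∀ x, (t (σ x)).1.2 = (t x).1.2 := (Finset.mem_filter.1 hσ).2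
  have hpair : ∀ i ε, σ (t.pairs i ε) = t.pairs i true ∨ σ (t.pairs i ε) = t.pairs i false :=
    fun i ε => t.eq_pairs (by rw [hcol, t.apply_pairs])
  have hne : ∀ i, σ (t.pairs i true) ≠ σ (t.pairs i false) := fun i h =>
    Bool.noConfusion (t.isPairing_pairs.1 _ _ _ _ (σ.injective h)).2
  refine ⟨fun i => if σ (t.pairs i true) = t.pairs i true then 1 else Equiv.swap true false, ?_⟩
  ext1 x
  rcases lt_or_ge (t x).1.2 (k : ℕ) with h | h
  · obtain ⟨i, ε, rfl⟩ : ∃ i ε, x = t.pairs i ε := by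
      rcases t.eq_pairs (i := ⟨_, h⟩) rfl with hx | hx
      · exact ⟨_, _, hx⟩
      · exact ⟨_, _, hx⟩
    rw [t.columnPerm_pairs]
    have h1 := hpair i true
    have h2 := hpair i false
    have h3 := hne i
    split_ifs with h4
    · cases ε
      · rw [h4] at h3
        exact (h2.resolve_left h3.symm).symm
      · exact h4.symm
    · have h5 := h1.resolve_left h4
      cases ε
      · rw [h5] at h3
        simpa using (h2.resolve_right h3.symm).symm
      · simpa using h5.symm
  · rw [t.columnPerm_of_le _ h]
    exact (t.eq_of_column_eq h (hcol x)).symm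

theorem sum_perm_bool (f : Bool → SfAlg n) :
    ∑ h : Equiv.Perm Bool, (((Equiv.Perm.sign h : ℤˣ) : ℤ) : ℚ) • f (h true) =
      f true - f false := by
  have : (Finset.univ : Finset (Equiv.Perm Bool)) = {1, Equiv.swap true false} := by decide
  rw [this, Finset.sum_pair (by decide), Equiv.Perm.sign_swap (by decide)]
  simp [sub_eq_add_neg]

/-- The column group is a product of k groups of order two. Expanding the product of differences
gives one signed monomial for each of its elements. -/
theorem monoMap_polytabloid (t : Tableau n (twoRow n k)) :
    monoMap Tabloid.secondRow t.polytabloid = pairProd t.pairs := by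
  rw [Tableau.polytabloid, map_sum, pairProd,
    Finset.prod_congr rfl fun i _ => (sum_perm_bool fun ε => gen (t.pairs i ε)).symm,
    Fintype.prod_sum]
  refine (Finset.sum_bij (fun g _ => t.columnPerm g) (fun g _ => t.columnPerm_mem g)
    (fun g _ h _ hgh => t.columnPerm_injective hgh) (fun σ hσ => ?_) (fun g _ => ?_)).symm
  · obtain ⟨g, hg⟩ := t.exists_columnPerm_eq hσ
    exact ⟨g, Finset.mem_univ _, hg⟩
  · rw [monoMap_single, Tabloid.secondRow_smul, t.mono_smul_secondRow, t.sign_columnPerm,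
      Finset.prod_smul]
    congr 1
    · push_cast
      rfl
    · exact Finset.prod_congr rfl fun i _ => by rw [t.columnPerm_pairs]

/-- Any tableau can be moved by a permutation so that its long columns become the prescribed pairs.
-/
theorem IsPairing.exists_tableau {ι : Fin k → Bool → Fin n} (h : IsPairing Finset.univ ι) :
    ∃ t : Tableau n (twoRow n k), t.pairs = ι := by
  obtain ⟨t⟩ : Nonempty (Tableau n (twoRow n k)) :=
    ⟨Fintype.equivOfCardEq (by rw [card_cells_twoRow, Fintype.card_fin])⟩
  obtain ⟨π, hπ⟩ := Equiv.Perm.exists_extending_pair t.pairsEmb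
    (fun p : Fin k × Bool => ι p.1 p.2) t.pairsEmb.injective
    (fun p q hpq => Prod.ext_iff.2 (h.1 _ _ _ _ hpq))
  exact ⟨π.symm.trans t, funext fun i => funext fun ε => hπ (i, ε)⟩

/-- The embedding of the Specht module `V_(n-k,k)` into `Sf(n)`. -/
def spechtMap (n : ℕ) (k : Fin (n / 2 + 1)) : VSpace n k →ₗ[ℚ] SfAlg n :=
  monoMap Tabloid.secondRow ∘ₗ (specht n (twoRow n k)).toSubmodule.subtype

theorem spechtMap_injective : Function.Injective (spechtMap n k) :=
  (monoMap_injective Tabloid.secondRow_injective).comp Subtype.val_injective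

theorem spechtMap_equivariant (π : Equiv.Perm (Fin n)) (v : VSpace n k) :
    spechtMap n k (V n k π v) = Sf n π (spechtMap n k v) :=
  monoMap_ofMulAction Tabloid.secondRow_smul π v.1

theorem range_spechtMap : LinearMap.range (spechtMap n k) = prim Finset.univ (k : ℕ) := by
  rw [spechtMap, LinearMap.range_comp, Submodule.range_subtype, prim_eq_pairSpan]
  change Submodule.map _ (Submodule.span ℚ _) = _
  rw [Submodule.map_span, pairSpan]
  congr 1
  ext v
  constructor
  · rintro ⟨_, ⟨t, rfl⟩, rfl⟩
    exact ⟨t.pairs, t.isPairing_pairs, monoMap_polytabloid t⟩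
  · rintro ⟨ι, hι, rfl⟩
    obtain ⟨t, rfl⟩ := hι.exists_tableau
    exact ⟨_, ⟨t, rfl⟩, monoMap_polytabloid t⟩

/-! ### Assembling the isomorphisms -/

/-- The embedding of the Specht module `V_(n-j,j)` onto `summand (j, c)`. -/
def summandMap (p : Idx n) : VSpace n p.1 →ₗ[ℚ] SfAlg n :=
  LinearMap.mulLeft ℚ (genSum Finset.univ ^ (p.2 : ℕ)) ∘ₗ spechtMap n p.1

theorem range_summandMap (p : Idx n) : LinearMap.range (summandMap p) = summand p := by
  rw [summandMap, LinearMap.range_comp, range_spechtMap, summand]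

theorem summandMap_injective (p : Idx n) : Function.Injective (summandMap p) := by
  rw [← LinearMap.ker_eq_bot, LinearMap.ker_eq_bot']
  intro v hv
  refine spechtMap_injective ((genSum_pow_mul_injOn (p := p) ?_ hv).trans (map_zero _).symm)
  rw [← range_spechtMap]
  exact ⟨v, rfl⟩

theorem summandMap_equivariant (p : Idx n) (π : Equiv.Perm (Fin n)) (v : VSpace n p.1) :
    summandMap p (V n p.1 π v) = Sf n π (summandMap p v) := by
  change genSum Finset.univ ^ (p.2 : ℕ) * spechtMap n p.1 (V n p.1 π v) =
    Sf n π (genSum Finset.univ ^ (p.2 : ℕ) * spechtMap n p.1 v)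
  rw [spechtMap_equivariant, Sf_genSum_pow_mul]

theorem iSupIndep_range_summandMap :
    iSupIndep fun p : Idx n => LinearMap.range (summandMap p) := by
  simpa only [range_summandMap] using iSupIndep_summand

theorem iSup_range_summandMap : ⨆ p : Idx n, LinearMap.range (summandMap p) = ⊤ := by
  simpa only [range_summandMap] using iSup_summand

theorem nonempty_equiv_LP_fullSum (n : ℕ) : Nonempty ((LP n).Equiv (fullSum n)) :=
  nonempty_equiv_directSum (τ := Sf n) (monoMap id) (monoMap_injective Function.injective_id)
    (fun π v => monoMap_ofMulAction (fun _ _ => rfl) π v) summandMap summandMap_injective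
    summandMap_equivariant iSupIndep_range_summandMap
    (range_monoMap_id.trans iSup_range_summandMap.symm)

theorem nonempty_equiv_Sf_fullSum (n : ℕ) : Nonempty ((Sf n).Equiv (fullSum n)) :=
  nonempty_equiv_directSum (τ := Sf n) LinearMap.id Function.injective_id
    (fun _ _ => rfl) summandMap summandMap_injective
    summandMap_equivariant iSupIndep_range_summandMap
    (LinearMap.range_id.trans iSup_range_summandMap.symm)

theorem nonempty_equiv_SfHom_compl {k : ℕ} (hk : k ≤ n) :
    Nonempty ((SfHom n k).toRepresentation.Equiv (SfHom n (n - k)).toRepresentation) := by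
  have hinv : Function.Involutive (complMap n) := complMap_complMap
  refine nonempty_equiv_of_range_eq (τ := Sf n) (complMap n ∘ₗ (SfHom n k).toSubmodule.subtype)
    (SfHom n (n - k)).toSubmodule.subtype (hinv.injective.comp Subtype.val_injective)
    Subtype.val_injective (fun π v => Sf_complMap π v.1) (fun _ _ => rfl) ?_
  rw [LinearMap.range_comp, Submodule.range_subtype, Submodule.range_subtype, SfHom_toSubmodule,
    SfHom_toSubmodule]
  refine le_antisymm ?_ fun v hv => ⟨complMap n v, ?_, complMap_complMap v⟩
  · rintro _ ⟨v, hv, rfl⟩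
    exact complMap_mem_homog hv
  · have := complMap_mem_homog hv
    rwa [Nat.sub_sub_self hk] at this

theorem nonempty_equiv_SfFil_sumUpTo (i k : Fin (n / 2 + 1)) (hik : i ≤ k) :
    Nonempty ((SfFil n i k).toRepresentation.Equiv (sumUpTo n i)) := by
  let p : {j : Fin (n / 2 + 1) // j ≤ i} → Idx n := fun j => ⟨j.1, ⟨(k : ℕ) - j.1, by omega⟩⟩
  have hp : Function.Injective p := fun j j' h => Subtype.ext (congrArg Sigma.fst h)
  refine nonempty_equiv_directSum (τ := Sf n) (SfFil n i k).toSubmodule.subtype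
    Subtype.val_injective (fun _ _ => rfl) (fun j => summandMap (p j))
    (fun j => summandMap_injective (p j)) (fun j => summandMap_equivariant (p j))
    (iSupIndep_range_summandMap.comp hp) ?_
  rw [Submodule.range_subtype, SfFil_toSubmodule_eq_iSup i k hik]
  exact iSup_congr fun j => (range_summandMap (p j)).symm

/-! ### Floor and ceiling forms of the indices -/

theorem sub_half_eq_ceil (n : ℕ) : n - n / 2 = ⌈(n : ℚ) / 2⌉₊ := by
  refine le_antisymm ?_ (Nat.ceil_le.2 ?_)
  · have h := Nat.le_ceil ((n : ℚ) / 2)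
    rw [div_le_iff₀ (by norm_num)] at h
    have h' : n ≤ ⌈(n : ℚ) / 2⌉₊ * 2 := by exact_mod_cast h
    omega
  · rw [div_le_iff₀ (by norm_num)]
    have h : n ≤ (n - n / 2) * 2 := by omega
    exact_mod_cast h

theorem half_eq_floor (n : ℕ) : n / 2 = ⌊(n : ℚ) / 2⌋₊ := by
  rw [Nat.floor_div_ofNat, Nat.floor_natCast]

end SqFree

end

theorem corollary2p7 (n : ℕ) :
    Nonempty ((SqFree.LP n).Equiv (SqFree.fullSum n)) ∧
    Nonempty ((SqFree.Sf n).Equiv (SqFree.fullSum n)) ∧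
    (∀ k : Fin (n / 2 + 1), Nonempty
      ((SqFree.SfHom n k).toRepresentation.Equiv (SqFree.SfHom n (n - k)).toRepresentation)) ∧
    (∀ i k : Fin (n / 2 + 1), i ≤ k → Nonempty
      ((SqFree.SfFil n i k).toRepresentation.Equiv (SqFree.sumUpTo n i))) ∧
    (∀ k : Fin (n / 2 + 1), Nonempty
      ((SqFree.SfHom n k).toRepresentation.Equiv (SqFree.sumUpTo n k))) ∧
    (n - n / 2 = ⌈(n : ℚ) / 2⌉₊ ∧ n / 2 = ⌊(n : ℚ) / 2⌋₊ ∧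
      n - 2 * (n / 2) + 1 = ⌈(n : ℚ) / 2⌉₊ - ⌊(n : ℚ) / 2⌋₊ + 1) := by
  refine ⟨SqFree.nonempty_equiv_LP_fullSum n, SqFree.nonempty_equiv_Sf_fullSum n,
    fun k => SqFree.nonempty_equiv_SfHom_compl (by omega),
    SqFree.nonempty_equiv_SfFil_sumUpTo, fun k => ?_,
    SqFree.sub_half_eq_ceil n, SqFree.half_eq_floor n, ?_⟩
  -- The whole degree k component is the last step i = k of its filtration.
  · rw [← SqFree.SfFil_self]
    exact SqFree.nonempty_equiv_SfFil_sumUpTo k k le_rfl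
  · rw [← SqFree.sub_half_eq_ceil, ← SqFree.half_eq_floor]
    omega
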